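/- **Setting.** Let $H$ be a separable reproducing kernel Hilbert space of real functions on a measurable space $\mathcal X$, with kernel $k$ such that $k(x,\cdot)$ is measurable for every $x$, and let $\nu$ be a probability measure on $\mathcal X$ with $\int k(x,x)\,d\nu(x)<\infty$. Let $Cf=\int k(\cdot,x')f(x')\,d\nu(x')$ for $f\in H$, let $r(x,x')=\int k(x,\xi)k(\xi,x')\,d\nu(\xi)$, and let $C=\sum_{m\ge1}\lambda_m\langle\cdot,e_m\rangle e_m$ be the spectral decomposition of $C$ in $H$, with $\lambda_1\ge\lambda_2\ge\dots\ge0$ and the $e_m$ with $\lambda_m>0$ orthonormal in $H$. Let $M$ be such that $\lambda_1,\dots,\lambda_M>0$ and put $\Lambda_M=\mathrm{diag}(\lambda_1,\dots,\lambda_M)$. Let $F\sim\Pi=\mathcal N(0,C)$ be the Gaussian prior on $H$, let $F^{1:M}=(\langle F,e_1\rangle,\dots,\langle F,e_M\rangle)$, and for a probability measure $\tau$ on $\mathbb R^M$ let $$\Pi_\tau=\int_{\mathbb R^M}\mathbb P(F\in\cdot\mid F^{1:M}=u)\,d\tau(u),$$ where the conditional law is the version that is weakly continuous in $u$, i.e.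 the law of $F+\sum_{m\le M}(u_m-\langle F,e_m\rangle)e_m$. Let $N\in\mathbb N$, $\ell_N:\mathbb R^N\to\mathbb R$ and $x_{1:N}=(x_1,\dots,x_N)\in\mathcal X^N$. The Bayes posterior $\Pi_{\mathrm B}$ has density proportional to $f\mapsto\exp(-\ell_N(f(x_{1:N})))$ with respect to $\Pi$. The optimal variational approximation $\Pi_M^*$ is the minimiser of $Q\mapsto\mathrm{KL}(Q,\Pi_{\mathrm B})$ over all $Q=\Pi_\tau$ with $\tau$ a probability measure on $\mathbb R^M$ with finite second moment. The measure targeted by projected Langevin sampling is $\Pi_\infty=\Pi_\tau$ for $\tau=\Pi_\infty^{1:M}$, the probability measure on $\mathbb R^M$ with Lebesgue density proportional to $\exp(-V_\infty)$, $$V_\infty(u)=\ell_N(\mu_u(x_{1:N}))+\tfrac12u^T\Lambda_M^{-1}u,\qquad \mu_u(x_{1:N})=\Big(\sum_{m=1}^Mu_me_m(x_n)\Big)_{n=1}^N$$ (the limiting law of the Langevin diffusion with potential $V_\infty$). Finally let $$\Sigma(x_{1:N})=\Big(r(x_n,x_{n'})-\sum_{m=1}^M\lambda_me_m(x_n)e_m(x_{n'})\Big)_{n,n'=1}^N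 .$$ **Theorem.** Assume that $\ell_N$ is convex and, for some $\kappa>0$, $\kappa$-Lipschitz with respect to the Euclidean norm. Then for every $x_{1:N}\in\mathcal X^N$ the minimiser $\Pi_M^*$ exists and is unique, and $$\mathrm{KL}(\Pi_\infty,\Pi_M^*)\le\frac{\kappa^2}{2}\operatorname{tr}\Sigma(x_{1:N})=\frac{\kappa^2}{2}\sum_{m=M+1}^\infty\lambda_m\sum_{n=1}^Ne_m(x_n)^2 .$$ Further, if $x_1,\dots,x_N$ are independent and identically distributed according to $\nu$ (with the function $\ell_N$ fixed), then $$\mathbb E_{x_{1:N}}\big[\mathrm{KL}(\Pi_\infty,\Pi_M^*)\big]\le\frac{N\kappa^2}{2}\sum_{m=M+1}^\infty\lambda_m^2<\infty .$$ -/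

import Mathlib

open MeasureTheory ProbabilityTheory InformationTheory
open scoped RealInnerProductSpace ENNReal NNReal

namespace FunctionSpaceInference

noncomputable section

/-! ### The prior -/

/-- The reproducing kernel `k` of the reproducing kernel Hilbert space `H` of real functions
on `X`. -/
def kernelFun {X : Type*} (H : Type*) [NormedAddCommGroup H] [InnerProductSpace ℝ H]
    [CompleteSpace H] [RKHS ℝ H X ℝ] (x x' : X) : ℝ :=
  RKHS.kernel H x x' 1

/-- The canonical feature `k(·, x)` of the point `x`, as an element of `H`. -/
def feature {X : Type*} (H : Type*) [NormedAddCommGroup H] [InnerProductSpace ℝ H]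
    [CompleteSpace H] [RKHS ℝ H X ℝ] (x : X) : H :=
  RKHS.kerFun H x 1

/-- The operator `C f = ∫ k(·, x') f(x') dν(x')` on `H` (a Bochner integral in `H`). -/
def covOp {X H : Type*} [NormedAddCommGroup H] [InnerProductSpace ℝ H]
    [CompleteSpace H] [RKHS ℝ H X ℝ] [MeasurableSpace X] (ν : Measure X) (f : H) : H :=
  ∫ x', f x' • feature H x' ∂ν

/-- The kernel `r(x, x') = ∫ k(x, ξ) k(ξ, x') dν(ξ)`. -/
def smoothedKernel {X : Type*} (H : Type*) [NormedAddCommGroup H] [InnerProductSpace ℝ H]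
    [CompleteSpace H] [RKHS ℝ H X ℝ] [MeasurableSpace X] (ν : Measure X) (x x' : X) : ℝ :=
  ∫ ξ, kernelFun H x ξ * kernelFun H ξ x' ∂ν

/-- `P` is the Gaussian measure `N(0, C)` on `H`. -/
structure IsCenteredGaussian {H : Type*} [NormedAddCommGroup H] [InnerProductSpace ℝ H]
    [MeasurableSpace H] (P : Measure H) (C : H → H) : Prop where
  gaussian : IsGaussian P
  mean_eq : ∫ h, h ∂P = 0
  cov_eq : ∀ f g : H, ∫ h, ⟪h, f⟫ * ⟪h, g⟫ ∂P = ⟪C f, g⟫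

/-- `C = ∑ₘ lam m ⟨·, e m⟩ e m` is a spectral decomposition of `C`, with eigenvalues in decreasing
order. The index starts at `0`. If `C` has finite rank, the sequence of eigenvalues is continued by
zeros; the vectors `e m` with `lam m = 0` play no role and are not restricted. -/
structure IsSpectralDecomposition {H : Type*} [NormedAddCommGroup H] [InnerProductSpace ℝ H]
    (C : H → H) (lam : ℕ → ℝ) (e : ℕ → H) : Prop where
  nonneg : ∀ m, 0 ≤ lam m
  antitone : Antitone lam
  orthonormal : Orthonormal ℝ (fun m : {m : ℕ // 0 < lam m} => e m)
  hasSum : ∀ f, HasSum (fun m => (lam m * ⟪e m, f⟫) • e m) (C f)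

/-! ### Conditioning on the first `M` coefficients -/

/-- The first `M` coefficients `(⟨f, e 0⟩, …, ⟨f, e (M - 1)⟩)` of `f`. -/
def coeffs {H : Type*} [NormedAddCommGroup H] [InnerProductSpace ℝ H] (e : ℕ → H) (M : ℕ)
    (f : H) : EuclideanSpace ℝ (Fin M) :=
  WithLp.toLp 2 (fun m => ⟪e m, f⟫)

/-- The function `f` with its first `M` coefficients replaced by `u`. -/
def replaceCoeffs {H : Type*} [NormedAddCommGroup H] [InnerProductSpace ℝ H] (e : ℕ → H) {M : ℕ}
    (u : EuclideanSpace ℝ (Fin M)) (f : H) : H :=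
  f + ∑ m : Fin M, (u m - ⟪e m, f⟫) • e m

/-- The conditional law `u ↦ ℙ(F ∈ · | F^{1:M} = u)` of `F ∼ P = N(0, C)` given its first `M`
coefficients: the law of `F` with its first `M` coefficients replaced by `u`. By
`compProd_condLaw` this is a regular conditional law of `F`; it is the version which is weakly
continuous in `u`. -/
def condLaw {H : Type*} [NormedAddCommGroup H] [InnerProductSpace ℝ H] [MeasurableSpace H]
    (P : Measure H) (e : ℕ → H) (M : ℕ) : Kernel (EuclideanSpace ℝ (Fin M)) H :=
  (Kernel.id ×ₖ Kernel.const _ P).map (fun q => replaceCoeffs e q.1 q.2)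

theorem measurable_coeffs {H : Type*} [NormedAddCommGroup H] [InnerProductSpace ℝ H]
    [MeasurableSpace H] [BorelSpace H] [SecondCountableTopology H] (e : ℕ → H) (M : ℕ) :
    Measurable (coeffs e M) := by
  unfold coeffs
  fun_prop

theorem measurable_replaceCoeffs {H : Type*} [NormedAddCommGroup H] [InnerProductSpace ℝ H]
    [MeasurableSpace H] [BorelSpace H] [SecondCountableTopology H] (e : ℕ → H) (M : ℕ) :
    Measurable (fun q : EuclideanSpace ℝ (Fin M) × H => replaceCoeffs e q.1 q.2) := by
  unfold replaceCoeffs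
  fun_prop

theorem condLaw_apply {H : Type*} [NormedAddCommGroup H] [InnerProductSpace ℝ H]
    [MeasurableSpace H] [BorelSpace H] [SecondCountableTopology H] (P : Measure H)
    [IsProbabilityMeasure P] (e : ℕ → H) (M : ℕ) (u : EuclideanSpace ℝ (Fin M)) :
    condLaw P e M u = P.map (replaceCoeffs e u) := by
  rw [condLaw, Kernel.map_apply _ (measurable_replaceCoeffs e M), Kernel.prod_apply,
    Kernel.id_apply, Kernel.const_apply, Measure.dirac_prod,
    Measure.map_map (measurable_replaceCoeffs e M) measurable_prodMk_left]
  rfl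

theorem inner_orth {H : Type*} [NormedAddCommGroup H] [InnerProductSpace ℝ H]
    {C : H → H} {lam : ℕ → ℝ} {e : ℕ → H} (he : IsSpectralDecomposition C lam e) {i j : ℕ}
    (hi : 0 < lam i) (hj : 0 < lam j) : ⟪e i, e j⟫ = if i = j then (1 : ℝ) else 0 := by
  have h := (orthonormal_iff_ite.mp he.orthonormal) ⟨i, hi⟩ ⟨j, hj⟩
  simpa using h

theorem apply_eigen {H : Type*} [NormedAddCommGroup H] [InnerProductSpace ℝ H]
    {C : H → H} {lam : ℕ → ℝ} {e : ℕ → H} (he : IsSpectralDecomposition C lam e) {j : ℕ}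
    (hj : 0 < lam j) : C (e j) = lam j • e j := by
  refine (he.hasSum (e j)).unique ?_
  have h0 : ∀ m, m ≠ j → (lam m * ⟪e m, e j⟫) • e m = 0 := by
    intro m hm
    rcases (he.nonneg m).eq_or_lt with h | h
    · simp [← h]
    · simp [inner_orth he h hj, hm]
  have h1 := hasSum_single j h0
  rwa [inner_orth he hj hj, if_pos rfl, mul_one] at h1

/-- `condLaw` is a regular conditional law of `F ∼ N(0, C)` given its first `M` coefficients. -/
theorem compProd_condLaw {H : Type*} [NormedAddCommGroup H] [InnerProductSpace ℝ H]
    [CompleteSpace H] [MeasurableSpace H] [BorelSpace H] [SecondCountableTopology H]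
    {P : Measure H} {C : H → H} {lam : ℕ → ℝ} {e : ℕ → H} (hP : IsCenteredGaussian P C)
    (he : IsSpectralDecomposition C lam e) {M : ℕ} (hM : ∀ m < M, 0 < lam m) :
    (P.map (coeffs e M)) ⊗ₘ (condLaw P e M) = P.map (fun f => (coeffs e M f, f)) := by
  have := hP.gaussian
  have hMF : ∀ m : Fin M, 0 < lam m := fun m => hM m m.2
  have hmc := measurable_coeffs e M
  have hmr := measurable_replaceCoeffs e M
  -- the residual and the coefficients as continuous linear maps
  let R : H →L[ℝ] H := ContinuousLinearMap.id ℝ H -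
    ∑ m : Fin M, (innerSL ℝ (e m)).smulRight (e m)
  let Φ : H →L[ℝ] EuclideanSpace ℝ (Fin M) :=
    (PiLp.continuousLinearEquiv 2 ℝ (fun _ : Fin M => ℝ)).symm.toContinuousLinearMap ∘L
      ContinuousLinearMap.pi (fun m : Fin M => innerSL ℝ (e m))
  have hΦ : ∀ f, Φ f = coeffs e M f := fun f => rfl
  have hR : ∀ f, R f = f - ∑ m : Fin M, ⟪e m, f⟫ • e m := by
    intro f; simp [R]
  have hrep : ∀ u f, replaceCoeffs e u f = R f + ∑ m : Fin M, u m • e m := by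
    intro u f
    simp only [replaceCoeffs, hR, sub_smul, Finset.sum_sub_distrib]
    abel
  have hid : ∀ f, replaceCoeffs e (coeffs e M f) f = f := by
    intro f
    simp [replaceCoeffs, coeffs]
  have hind : IndepFun (coeffs e M) R P := by
    have hG : HasGaussianLaw (fun f => (Φ f, R f)) P :=
      (IsGaussian.hasGaussianLaw_id (μ := P)).map_fun (Φ.prod R)
    refine hG.indepFun_of_covariance_inner (fun a b => ?_)
    have h1 : ∀ f, ⟪a, Φ f⟫ = ⟪f, ∑ m : Fin M, a m • e m⟫ := by
      intro f
      simp [hΦ, coeffs, PiLp.inner_apply, inner_sum, inner_smul_right, real_inner_comm, mul_comm]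
    have h2 : ∀ f, ⟪b, R f⟫ = ⟪f, R b⟫ := by
      intro f
      simp only [hR, inner_sub_right, inner_sum, inner_smul_right, real_inner_comm]
      congr 1
      refine Finset.sum_congr rfl (fun m _ => ?_)
      ring
    have hL : ∀ h : H, MemLp (fun f => ⟪f, h⟫) 2 P := by
      intro h
      simpa [real_inner_comm] using! IsGaussian.memLp_dual P (innerSL ℝ h) 2 (by simp)
    have h0 : ∀ h : H, ∫ f, ⟪f, h⟫ ∂P = 0 := by
      intro h
      have := (innerSL ℝ h).integral_comp_comm (IsGaussian.integrable_id (μ := P))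
      simpa [hP.mean_eq, real_inner_comm] using this
    simp only [h1, h2]
    rw [covariance_eq_sub (hL _) (hL _), h0, h0]
    have hRb : ∀ m : Fin M, ⟪e m, R b⟫ = 0 := by
      intro m
      simp only [hR, inner_sub_right, inner_sum, inner_smul_right]
      rw [Finset.sum_eq_single m]
      · rw [inner_orth he (hMF m) (hMF m), if_pos rfl]
        ring
      · intro j _ hj
        simp [inner_orth he (hMF m) (hMF j), Fin.val_inj, hj.symm]
      · simp
    have h3 : ∫ f, ⟪f, ∑ m : Fin M, a m • e m⟫ * ⟪f, R b⟫ ∂P = 0 := by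
      simp only [inner_sum, inner_smul_right, Finset.sum_mul, mul_assoc]
      rw [integral_finsetSum]
      · refine Finset.sum_eq_zero (fun m _ => ?_)
        rw [integral_const_mul, hP.cov_eq, apply_eigen he (hMF m), real_inner_smul_left, hRb]
        simp
      · exact fun m _ => ((hL (e m)).integrable_mul (hL (R b))).const_mul _
    simpa using h3
  have hg : Measurable (fun q : EuclideanSpace ℝ (Fin M) × H => q.2 + ∑ m : Fin M, q.1 m • e m) := by
    fun_prop
  have hg' : Measurable (fun q : EuclideanSpace ℝ (Fin M) × H =>
      (q.1, q.2 + ∑ m : Fin M, q.1 m • e m)) := measurable_fst.prodMk hg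
  have hk : ∀ u, condLaw P e M u = (P.map R).map (fun f => f + ∑ m : Fin M, u m • e m) := by
    intro u
    rw [condLaw_apply, Measure.map_map (by fun_prop) (by fun_prop)]
    congr 1
    funext f
    exact hrep u f
  have : IsProbabilityMeasure (P.map (coeffs e M)) :=
    Measure.isProbabilityMeasure_map hmc.aemeasurable
  have : IsMarkovKernel (condLaw P e M) := Kernel.IsMarkovKernel.map _ hmr
  have hRP : IsProbabilityMeasure (P.map R) :=
    Measure.isProbabilityMeasure_map (by fun_prop)
  calc (P.map (coeffs e M)) ⊗ₘ (condLaw P e M)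
      = ((P.map (coeffs e M)).prod (P.map R)).map (fun q : EuclideanSpace ℝ (Fin M) × H =>
          (q.1, q.2 + ∑ m : Fin M, q.1 m • e m)) := by
        ext s hs
        rw [Measure.compProd_apply hs, Measure.map_apply hg' hs, Measure.prod_apply (hg' hs)]
        refine lintegral_congr (fun u => ?_)
        rw [hk, Measure.map_apply (by fun_prop) (measurable_prodMk_left hs)]
        rfl
    _ = P.map (fun f => (coeffs e M f, f)) := by
        rw [← (indepFun_iff_map_prod_eq_prod_map_map hmc.aemeasurable
          (by fun_prop)).mp hind, Measure.map_map hg' (hmc.prodMk (by fun_prop))]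
        congr 1
        funext f
        have := hrep (coeffs e M f) f
        rw [hid] at this
        simp only [Function.comp, ← this]

/-! ### Posterior and variational family -/

/-- The vector `f(x_{1:N}) = (f(x_1), …, f(x_N))`. -/
def evalAt {X H : Type*} [NormedAddCommGroup H] [InnerProductSpace ℝ H] [RKHS ℝ H X ℝ] {N : ℕ}
    (x : Fin N → X) (f : H) : EuclideanSpace ℝ (Fin N) :=
  WithLp.toLp 2 (fun n => f (x n))

/-- The Bayes posterior with prior `P` and negative log likelihood `f ↦ ℓ (f(x_{1:N}))`: the
probability measure with density proportional to `exp (- ℓ (f(x_{1:N})))` with respect to `P`. -/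
def bayesPosterior {X H : Type*} [NormedAddCommGroup H] [InnerProductSpace ℝ H] [RKHS ℝ H X ℝ]
    [MeasurableSpace H] (P : Measure H) {N : ℕ} (l : EuclideanSpace ℝ (Fin N) → ℝ)
    (x : Fin N → X) : Measure H :=
  P.tilted (fun f => - l (evalAt x f))

/-- The measure `∫ ℙ(F ∈ · | F^{1:M} = u) dτ(u)` on `H`. -/
def mixture {H : Type*} [NormedAddCommGroup H] [InnerProductSpace ℝ H] [MeasurableSpace H]
    (P : Measure H) (e : ℕ → H) {M : ℕ} (τ : Measure (EuclideanSpace ℝ (Fin M))) : Measure H :=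
  τ.bind (condLaw P e M)

/-- The nonparametric variational family: the mixtures with mixing measure `τ` any probability
measure on `ℝ^M` with finite second moment. -/
def variationalFamily {H : Type*} [NormedAddCommGroup H] [InnerProductSpace ℝ H]
    [MeasurableSpace H] (P : Measure H) (e : ℕ → H) (M : ℕ) : Set (Measure H) :=
  {Q | ∃ τ : Measure (EuclideanSpace ℝ (Fin M)),
    IsProbabilityMeasure τ ∧ ∫⁻ u, ‖u‖ₑ ^ 2 ∂τ < ∞ ∧ Q = mixture P e τ}

/-- `Q` minimises `KL(·, Π_B)` over the variational family, where `Π_B` is the Bayes posterior. -/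
def IsOptimalApprox {X H : Type*} [NormedAddCommGroup H] [InnerProductSpace ℝ H] [RKHS ℝ H X ℝ]
    [MeasurableSpace H] (P : Measure H) (e : ℕ → H) (M : ℕ) {N : ℕ}
    (l : EuclideanSpace ℝ (Fin N) → ℝ) (x : Fin N → X) (Q : Measure H) : Prop :=
  Q ∈ variationalFamily P e M ∧
    ∀ Q' ∈ variationalFamily P e M,
      klDiv Q (bayesPosterior P l x) ≤ klDiv Q' (bayesPosterior P l x)

/-! ### Projected Langevin sampling -/

/-- The vector `μ_u(x_{1:N}) = uᵀ e^{1:M}(x_{1:N})`, with entries `∑ₘ u m * e m (x n)`. -/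
def projMean {X H : Type*} [NormedAddCommGroup H] [InnerProductSpace ℝ H] [RKHS ℝ H X ℝ]
    (e : ℕ → H) {M N : ℕ} (x : Fin N → X) (u : EuclideanSpace ℝ (Fin M)) :
    EuclideanSpace ℝ (Fin N) :=
  WithLp.toLp 2 (fun n => ∑ m : Fin M, u m * e m (x n))

/-- The potential `V_∞(u) = ℓ (μ_u(x_{1:N})) + uᵀ Λ_M⁻¹ u / 2` of the projected Langevin
diffusion. -/
def plsPotential {X H : Type*} [NormedAddCommGroup H] [InnerProductSpace ℝ H] [RKHS ℝ H X ℝ]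
    (lam : ℕ → ℝ) (e : ℕ → H) (M : ℕ) {N : ℕ} (l : EuclideanSpace ℝ (Fin N) → ℝ)
    (x : Fin N → X) (u : EuclideanSpace ℝ (Fin M)) : ℝ :=
  l (projMean e x u) + 1 / 2 * ∑ m : Fin M, (lam m)⁻¹ * u m ^ 2

/-- The limiting measure of the projected Langevin diffusion: the probability measure on `ℝ^M` with
Lebesgue density proportional to `exp (- V_∞)`. -/
def plsCoeffLaw {X H : Type*} [NormedAddCommGroup H] [InnerProductSpace ℝ H] [RKHS ℝ H X ℝ]
    (lam : ℕ → ℝ) (e : ℕ → H) (M : ℕ) {N : ℕ} (l : EuclideanSpace ℝ (Fin N) → ℝ)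
    (x : Fin N → X) : Measure (EuclideanSpace ℝ (Fin M)) :=
  volume.tilted (fun u => - plsPotential lam e M l x u)

/-- The measure `Π_∞` on `H` targeted by projected Langevin sampling. -/
def plsMeasure {X H : Type*} [NormedAddCommGroup H] [InnerProductSpace ℝ H] [RKHS ℝ H X ℝ]
    [MeasurableSpace H] (P : Measure H) (lam : ℕ → ℝ) (e : ℕ → H) (M : ℕ) {N : ℕ}
    (l : EuclideanSpace ℝ (Fin N) → ℝ) (x : Fin N → X) : Measure H :=
  mixture P e (plsCoeffLaw lam e M l x)

/-- The matrix `Σ(x_{1:N}) = r(x_{1:N}, x_{1:N}) - e^{1:M}(x_{1:N})ᵀ Λ_M e^{1:M}(x_{1:N})`. -/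
def residualCov {X H : Type*} [NormedAddCommGroup H] [InnerProductSpace ℝ H] [CompleteSpace H]
    [RKHS ℝ H X ℝ] [MeasurableSpace X] (ν : Measure X) (lam : ℕ → ℝ) (e : ℕ → H) (M : ℕ)
    {N : ℕ} (x : Fin N → X) : Matrix (Fin N) (Fin N) ℝ :=
  Matrix.of (fun n n' => smoothedKernel H ν (x n) (x n')) -
    (Matrix.of (fun (m : Fin M) n => e m (x n))).transpose *
      Matrix.diagonal (fun m : Fin M => lam m) * Matrix.of (fun (m : Fin M) n => e m (x n))

end

end FunctionSpaceInference

/-! Both measures are exponential tilts of the prior `P` by functions of the first `M` coefficients.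
Write `W(u)` for the conditional mean loss `meanLoss`. The Langevin target is the tilt by `-ℓ(μ_u)`
(`plsMeasure_eq_tilted`), because the coefficients are `N(0, Λ_M)` under `P` and tilting the mixing
law tilts the mixture. The optimal approximation is the tilt by `-W(u)` (`isOptimalApprox_iff`): for
every member `Q` of the variational family the expected loss equals the expectation of `W` at the
coefficients, so the divergences from `Q` to the posterior and to this tilt differ by a constant
independent of `Q`.

The two exponents are close. Given the coefficients, `F(x_{1:N})` is `μ_u` plus a centred residual,
so Jensen gives `ℓ(μ_u) ≤ W(u)`, and the Lipschitz bound with Cauchy-Schwarz gives `W(u) - ℓ(μ_u) ≤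
s` with `s = κ √(tr Σ)`. Two tilts whose exponents differ by `d ∈ [0, s]` have divergence `E d + log
E exp(-d) ≤ E d² / 2 ≤ s² / 2` (`klDiv_tilted_tilted_le`), which is the bound for fixed inputs.

For random inputs, `tr Σ` is the tail series of `λ_m ∑ₙ e_m(x_n)²`, and `∫ e_m² dν = ⟨C e_m, e_m⟩ =
λ_m` whenever `λ_m > 0`; integrating term by term gives `N ∑ λ_m²`. -/

namespace FunctionSpaceInference

/-! ### Kullback-Leibler divergence between exponential tilts. -/

section KullbackLeibler

variable {Ω : Type*} [MeasurableSpace Ω] {P : Measure Ω} [IsProbabilityMeasure P] {a b : Ω → ℝ}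

theorem integrable_llr_tilted_self (ha : Integrable (fun x => Real.exp (a x)) P)
    (haa : Integrable a (P.tilted a)) : Integrable (llr (P.tilted a) P) (P.tilted a) := by
  have := isProbabilityMeasure_tilted ha
  have h := (tilted_absolutelyContinuous P a).ae_le (log_rnDeriv_tilted_left_self ha)
  exact (integrable_congr h).mpr (haa.sub (integrable_const _))

/-- The Kullback-Leibler divergence between two exponential tilts of the same measure. -/
theorem klDiv_tilted_tilted (ha : Integrable (fun x => Real.exp (a x)) P)
    (hb : Integrable (fun x => Real.exp (b x)) P) (haa : Integrable a (P.tilted a))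
    (hba : Integrable b (P.tilted a)) :
    klDiv (P.tilted a) (P.tilted b) = ENNReal.ofReal (∫ x, (a x - b x) ∂(P.tilted a)
      - Real.log (∫ x, Real.exp (a x) ∂P) + Real.log (∫ x, Real.exp (b x) ∂P)) := by
  have := isProbabilityMeasure_tilted ha
  have := isProbabilityMeasure_tilted hb
  have hac := tilted_absolutelyContinuous P a
  have h : llr (P.tilted a) P =ᵐ[P.tilted a]
      fun x => a x - Real.log (∫ x, Real.exp (a x) ∂P) :=
    hac.ae_le (log_rnDeriv_tilted_left_self ha)
  have hi := integrable_llr_tilted_self ha haa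
  have hval : ∫ x, llr (P.tilted a) P x ∂(P.tilted a)
      = ∫ x, a x ∂(P.tilted a) - Real.log (∫ x, Real.exp (a x) ∂P) := by
    rw [integral_congr_ae h, integral_sub haa (integrable_const _)]
    simp
  rw [klDiv_of_ac_of_integrable (hac.trans (absolutelyContinuous_tilted hb))
    (integrable_llr_tilted_right hac hba hi hb), integral_llr_tilted_right hac hba hb hi, hval,
    integral_sub haa hba]
  simp only [probReal_univ]
  congr 1
  ring

/-- The closed formula for the divergence involves only parameter integrals against the fixed
measure `P`, and these are measurable in the parameter. -/
theorem measurable_klDiv_tilted_tilted {Y : Type*} [MeasurableSpace Y] {a b : Y × Ω → ℝ}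
    (ha : Measurable a) (hb : Measurable b)
    (h : ∀ y, Integrable (fun x => Real.exp (a (y, x))) P ∧
      Integrable (fun x => Real.exp (b (y, x))) P ∧
      Integrable (fun x => a (y, x)) (P.tilted (fun x => a (y, x))) ∧
      Integrable (fun x => b (y, x)) (P.tilted (fun x => a (y, x)))) :
    Measurable (fun y => klDiv (P.tilted (fun x => a (y, x))) (P.tilted (fun x => b (y, x)))) := by
  have hint : ∀ {F : Y × Ω → ℝ}, Measurable F → Measurable (fun y => ∫ x, F (y, x) ∂P) :=
    fun hF => hF.stronglyMeasurable.integral_prod_right'.measurable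
  have hformula : ∀ y, klDiv (P.tilted (fun x => a (y, x))) (P.tilted (fun x => b (y, x)))
      = ENNReal.ofReal ((∫ x, (Real.exp (a (y, x)) / ∫ x', Real.exp (a (y, x')) ∂P)
          * (a (y, x) - b (y, x)) ∂P)
        - Real.log (∫ x, Real.exp (a (y, x)) ∂P) + Real.log (∫ x, Real.exp (b (y, x)) ∂P)) := by
    intro y
    obtain ⟨h1, h2, h3, h4⟩ := h y
    rw [klDiv_tilted_tilted h1 h2 h3 h4, integral_tilted]
    simp only [smul_eq_mul]
  simp_rw [hformula]
  have hZ : Measurable (fun y => ∫ x, Real.exp (a (y, x)) ∂P) := hint ha.exp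
  have hZb : Measurable (fun y => ∫ x, Real.exp (b (y, x)) ∂P) := hint hb.exp
  have hw : Measurable (fun p : Y × Ω =>
      (Real.exp (a p) / ∫ x', Real.exp (a (p.1, x')) ∂P) * (a p - b p)) :=
    (ha.exp.div (hZ.comp measurable_fst)).mul (ha.sub hb)
  exact (((hint hw).sub hZ.log).add hZb.log).ennreal_ofReal

/-- Follows from `exp t ≥ 1 + t + t²/2` and `(1 - t + t²/2)(1 + t + t²/2) = 1 + t⁴/4 ≥ 1`. -/
theorem exp_neg_le_quadratic {t : ℝ} (ht : 0 ≤ t) : Real.exp (-t) ≤ 1 - t + t ^ 2 / 2 := by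
  have h1 : 1 + t + t ^ 2 / 2 ≤ Real.exp t := Real.quadratic_le_exp_of_nonneg ht
  rw [Real.exp_neg, inv_le_comm₀ (Real.exp_pos t) (by nlinarith [sq_nonneg (t - 1)])]
  refine le_trans ?_ h1
  rw [inv_le_iff_one_le_mul₀ (by nlinarith [sq_nonneg (t - 1)])]
  nlinarith [sq_nonneg (t ^ 2)]

/-- If two exponents differ by a function with values in `[0, s]`, then the Kullback-Leibler
divergence of the tilted measures is at most `s ^ 2 / 2`. -/
theorem klDiv_tilted_tilted_le (ha : Integrable (fun x => Real.exp (a x)) P)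
    (hb : Integrable (fun x => Real.exp (b x)) P) (haa : Integrable a (P.tilted a))
    (hba : Integrable b (P.tilted a)) {s : ℝ} (h0 : ∀ x, b x ≤ a x) (hs : ∀ x, a x - b x ≤ s) :
    klDiv (P.tilted a) (P.tilted b) ≤ ENNReal.ofReal (s ^ 2 / 2) := by
  have hPa := isProbabilityMeasure_tilted ha
  rw [klDiv_tilted_tilted ha hb haa hba]
  refine ENNReal.ofReal_le_ofReal ?_
  have hd : Integrable (fun x => a x - b x) (P.tilted a) := haa.sub hba
  have hpa := integral_exp_pos ha
  have hpb := integral_exp_pos hb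
  have hratio : ∫ x, Real.exp (b x - a x) ∂(P.tilted a)
      = (∫ x, Real.exp (b x) ∂P) / ∫ x, Real.exp (a x) ∂P := by
    rw [integral_exp_tilted a (fun x => b x - a x)]
    simp
  have hbd : ∫ x, Real.exp (b x - a x) ∂(P.tilted a)
      ≤ ∫ x, (1 - (a x - b x) + s ^ 2 / 2) ∂(P.tilted a) := by
    refine integral_mono_of_nonneg (ae_of_all _ fun x => (Real.exp_pos _).le)
      (((integrable_const _).sub hd).add (integrable_const _)) (ae_of_all _ fun x => ?_)
    have h1 := exp_neg_le_quadratic (sub_nonneg.mpr (h0 x))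
    rw [neg_sub] at h1
    have h2 : (a x - b x) ^ 2 ≤ s ^ 2 := pow_le_pow_left₀ (sub_nonneg.mpr (h0 x)) (hs x) 2
    simp only
    linarith
  have hquad : ∫ x, (1 - (a x - b x) + s ^ 2 / 2) ∂(P.tilted a)
      = 1 - ∫ x, (a x - b x) ∂(P.tilted a) + s ^ 2 / 2 := by
    rw [integral_add (by exact (integrable_const _).sub hd) (integrable_const _),
      integral_sub (integrable_const _) hd]
    simp
  rw [hquad, hratio] at hbd
  -- The ratio of normalising constants is `E exp(-d)` with `d = a - b`; `log z ≤ z - 1` together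
  -- with the quadratic bound makes the terms `E d` cancel.
  have hlog := Real.log_le_sub_one_of_pos (div_pos hpb hpa)
  rw [Real.log_div hpb.ne' hpa.ne'] at hlog
  linarith

theorem toReal_klDiv_tilted_right {Q : Measure Ω} [IsProbabilityMeasure Q] (hQP : Q ≪ P)
    (hb : Integrable (fun x => Real.exp (b x)) P) (hbQ : Integrable b Q)
    (hi : Integrable (llr Q P) Q) :
    (klDiv Q (P.tilted b)).toReal
      = ∫ x, llr Q P x ∂Q - ∫ x, b x ∂Q + Real.log (∫ x, Real.exp (b x) ∂P) := by
  have := isProbabilityMeasure_tilted hb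
  rw [toReal_klDiv_of_measure_eq (hQP.trans (absolutelyContinuous_tilted hb)) (by simp),
    integral_llr_tilted_right hQP hbQ hb hi]

/-- The log densities of `Q` relative to `P` and to its tilt differ by `b` and a constant, both
`Q`-integrable. -/
theorem integrable_llr_of_klDiv_tilted_ne_top {Q : Measure Ω} [IsProbabilityMeasure Q]
    (hb : Integrable (fun x => Real.exp (b x)) P) (hbQ : Integrable b Q)
    (h : klDiv Q (P.tilted b) ≠ ∞) : Q ≪ P ∧ Integrable (llr Q P) Q := by
  have := isProbabilityMeasure_tilted hb
  obtain ⟨hac, hi⟩ := klDiv_ne_top_iff.mp h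
  have hQP := hac.trans (tilted_absolutelyContinuous P b)
  refine ⟨hQP, ?_⟩
  rw [integrable_congr (llr_tilted_right hQP hb)] at hi
  have := hi.sub (hbQ.neg.add (integrable_const (Real.log (∫ z, Real.exp (b z) ∂P))))
  refine this.congr (ae_of_all _ fun x => ?_)
  simp

/-- If the exponents `g` and `h` have the same expectation under all elements of a family that
contains the tilt by `h`, then the tilt by `h` is the unique minimiser of the Kullback-Leibler
divergence from the tilt by `g` within the family. -/
theorem isMinOn_klDiv_tilted_iff {S : Set (Measure Ω)} {g h : Ω → ℝ}
    (hg : Integrable (fun x => Real.exp (g x)) P) (hh : Integrable (fun x => Real.exp (h x)) P)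
    (hS : ∀ Q ∈ S, IsProbabilityMeasure Q ∧ Integrable g Q ∧ Integrable h Q ∧
      ∫ x, g x ∂Q = ∫ x, h x ∂Q) (hmem : P.tilted h ∈ S) (Q : Measure Ω) :
    (Q ∈ S ∧ ∀ Q' ∈ S, klDiv Q (P.tilted g) ≤ klDiv Q' (P.tilted g)) ↔ Q = P.tilted h := by
  have := isProbabilityMeasure_tilted hg
  have hPh := isProbabilityMeasure_tilted hh
  -- The expectations of `g` and `h` under `Q` cancel, so only the normalising constants distinguish
  -- the two divergences.
  set c := Real.log (∫ x, Real.exp (g x) ∂P) - Real.log (∫ x, Real.exp (h x) ∂P) with hc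
  have key : ∀ Q ∈ S, klDiv Q (P.tilted g) ≠ ∞ →
      klDiv Q (P.tilted h) ≠ ∞ ∧
      (klDiv Q (P.tilted g)).toReal = (klDiv Q (P.tilted h)).toReal + c := by
    intro Q hQ hfin
    obtain ⟨hQp, hgQ, hhQ, heq⟩ := hS Q hQ
    obtain ⟨hQP, hi⟩ := integrable_llr_of_klDiv_tilted_ne_top hg hgQ hfin
    refine ⟨klDiv_ne_top (hQP.trans (absolutelyContinuous_tilted hh))
      (integrable_llr_tilted_right hQP hhQ hi hh), ?_⟩
    rw [toReal_klDiv_tilted_right hQP hg hgQ hi, toReal_klDiv_tilted_right hQP hh hhQ hi, heq]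
    ring
  obtain ⟨-, hgh, hhh, -⟩ := hS _ hmem
  have hopt : klDiv (P.tilted h) (P.tilted g) ≠ ∞ :=
    klDiv_ne_top ((tilted_absolutelyContinuous P h).trans (absolutelyContinuous_tilted hg))
      (integrable_llr_tilted_right (tilted_absolutelyContinuous P h) hgh
        (integrable_llr_tilted_self hh hhh) hg)
  -- Taking `Q` to be the tilt by `h` itself identifies `c` as the value attained there.
  have hoptval : (klDiv (P.tilted h) (P.tilted g)).toReal = c := by
    simpa using (key _ hmem hopt).2
  constructor
  · rintro ⟨hQ, hmin⟩
    obtain ⟨hQp, -⟩ := hS Q hQ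
    have hle := hmin _ hmem
    have hfin : klDiv Q (P.tilted g) ≠ ∞ := ne_top_of_le_ne_top hopt hle
    obtain ⟨hfin', hval⟩ := key Q hQ hfin
    have h1 := ENNReal.toReal_mono hopt hle
    rw [hval, hoptval] at h1
    have h2 : (klDiv Q (P.tilted h)).toReal = 0 :=
      le_antisymm (by linarith) ENNReal.toReal_nonneg
    -- Finiteness is needed here because `toReal` also sends `∞` to `0`.
    rw [ENNReal.toReal_eq_zero_iff, or_iff_left hfin'] at h2
    exact klDiv_eq_zero_iff.mp h2
  · rintro rfl
    refine ⟨hmem, fun Q' hQ' => ?_⟩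
    by_cases hfin : klDiv Q' (P.tilted g) = ∞
    · simp [hfin]
    · rw [← ENNReal.toReal_le_toReal hopt hfin, hoptval, (key Q' hQ' hfin).2]
      linarith [ENNReal.toReal_nonneg (a := klDiv Q' (P.tilted h))]

end KullbackLeibler

/-! ### Law of the leading coefficients and exponential moments of the prior. -/

section GaussianCoordinates

/-- By Fubini, both the integrals over boxes and the normalising constant factor over the
coordinates. -/
theorem pi_tilted {ι : Type*} [Fintype ι] (μ : ι → Measure ℝ) [∀ i, SigmaFinite (μ i)]
    [∀ i, NeZero (μ i)]
    (f : ι → ℝ → ℝ) (hf : ∀ i, Integrable (fun t => Real.exp (f i t)) (μ i)) :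
    Measure.pi (fun i => (μ i).tilted (f i))
      = (Measure.pi μ).tilted (fun u => ∑ i, f i (u i)) := by
  have := fun i => isProbabilityMeasure_tilted (hf i)
  refine Measure.pi_eq (fun s hs => ?_)
  rw [tilted_apply_eq_ofReal_integral' _ (MeasurableSet.univ_pi hs)]
  simp_rw [fun i => tilted_apply_eq_ofReal_integral' (μ := μ i) (f i) (hs i), Real.exp_sum,
    integral_div, Measure.restrict_pi_pi]
  rw [integral_fintype_prod_eq_prod (fun i t => Real.exp (f i t)),
    integral_fintype_prod_eq_prod (fun i t => Real.exp (f i t)),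
    ← ENNReal.ofReal_prod_of_nonneg (fun i _ => by positivity), Finset.prod_div_distrib]

theorem gaussianReal_eq_tilted {v : ℝ≥0} (hv : v ≠ 0) :
    gaussianReal 0 v = (volume : Measure ℝ).tilted (fun t => - (1 / 2 * ((v : ℝ)⁻¹ * t ^ 2))) := by
  have hv' : (0 : ℝ) < v := by positivity
  have hpdf : ∀ t, gaussianPDFReal 0 v t
      = (√(2 * Real.pi * v))⁻¹ * Real.exp (- (1 / 2 * ((v : ℝ)⁻¹ * t ^ 2))) := by
    intro t
    rw [gaussianPDFReal]
    congr 2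
    field_simp
    ring
  -- The normalising constant of the tilt is read off from the total mass of the Gaussian density.
  have hint := integral_gaussianPDFReal_eq_one 0 hv
  simp_rw [hpdf, integral_const_mul] at hint
  have hc : (√(2 * Real.pi * v))⁻¹ ≠ 0 := by positivity
  have hZ : (∫ t, Real.exp (- (1 / 2 * ((v : ℝ)⁻¹ * t ^ 2)))) = ((√(2 * Real.pi * v))⁻¹)⁻¹ :=
    eq_inv_of_mul_eq_one_right hint
  rw [gaussianReal_of_var_ne_zero 0 hv, Measure.tilted, hZ]
  congr 1
  funext t
  rw [gaussianPDF, hpdf, div_inv_eq_mul, mul_comm]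

theorem integrable_exp_neg_half_inv_mul_sq {v : ℝ≥0} (hv : v ≠ 0) :
    Integrable (fun t : ℝ => Real.exp (- (1 / 2 * ((v : ℝ)⁻¹ * t ^ 2)))) := by
  have hv' : (0 : ℝ) < v := by positivity
  refine (integrable_exp_neg_mul_sq (b := 1 / 2 * (v : ℝ)⁻¹) (by positivity)).congr
    (ae_of_all _ fun t => ?_)
  simp only
  congr 1
  ring

theorem integrable_exp_neg_half_sum {M : ℕ} {v : Fin M → ℝ≥0} (hv : ∀ m, v m ≠ 0) :
    Integrable (fun u : EuclideanSpace ℝ (Fin M) =>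
      Real.exp (- (1 / 2 * ∑ m : Fin M, (v m : ℝ)⁻¹ * u m ^ 2))) := by
  have h := Integrable.fintype_prod (μ := fun _ : Fin M => (volume : Measure ℝ))
    (fun m => integrable_exp_neg_half_inv_mul_sq (hv m))
  have h2 := (PiLp.volume_preserving_ofLp (Fin M)).integrable_comp_of_integrable h
  refine h2.congr (ae_of_all _ fun u => ?_)
  simp only [Function.comp, ← Real.exp_sum, Finset.sum_neg_distrib, Finset.mul_sum]

theorem map_toLp_pi_gaussianReal {M : ℕ} {v : Fin M → ℝ≥0} (hv : ∀ m, v m ≠ 0) :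
    (Measure.pi (fun m => gaussianReal 0 (v m))).map (WithLp.toLp 2)
      = (volume : Measure (EuclideanSpace ℝ (Fin M))).tilted
        (fun u => - (1 / 2 * ∑ m : Fin M, (v m : ℝ)⁻¹ * u m ^ 2)) := by
  simp_rw [fun m => gaussianReal_eq_tilted (hv m)]
  rw [pi_tilted _ _ (fun m => integrable_exp_neg_half_inv_mul_sq (hv m))]
  have hvp := PiLp.volume_preserving_toLp (Fin M)
  have hme : MeasurableEmbedding (WithLp.toLp 2 : (Fin M → ℝ) → EuclideanSpace ℝ (Fin M)) :=
    (MeasurableEquiv.toLp 2 (Fin M → ℝ)).measurableEmbedding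
  ext s hs
  rw [Measure.map_apply hvp.measurable hs, tilted_apply' _ _ hs,
    tilted_apply' _ _ (hvp.measurable hs), ← hvp.setLIntegral_comp_preimage_emb hme,
    ← hvp.integral_comp hme]
  simp [Finset.sum_neg_distrib, Finset.mul_sum, volume_pi]

variable {H : Type*} [NormedAddCommGroup H] [InnerProductSpace ℝ H] [MeasurableSpace H]
  [BorelSpace H] {P : Measure H} {C : H → H} {lam : ℕ → ℝ} {e : ℕ → H}

theorem IsCenteredGaussian.memLp_inner (hP : IsCenteredGaussian P C) (h : H) :
    MemLp (fun f => ⟪f, h⟫) 2 P := by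
  have := hP.gaussian
  simpa [real_inner_comm] using! IsGaussian.memLp_dual P (innerSL ℝ h) 2 (by simp)

variable [CompleteSpace H] [SecondCountableTopology H]

theorem IsCenteredGaussian.integral_inner (hP : IsCenteredGaussian P C) (h : H) :
    ∫ f, ⟪f, h⟫ ∂P = 0 := by
  have := hP.gaussian
  have := (innerSL ℝ h).integral_comp_comm (IsGaussian.integrable_id (μ := P))
  simpa [hP.mean_eq, real_inner_comm] using this

theorem IsCenteredGaussian.covariance_inner (hP : IsCenteredGaussian P C) (g h : H) :
    cov[fun f => ⟪f, g⟫, fun f => ⟪f, h⟫; P] = ⟪C g, h⟫ := by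
  have := hP.gaussian
  rw [covariance_eq_sub (hP.memLp_inner g) (hP.memLp_inner h), hP.integral_inner,
    hP.integral_inner]
  simpa using hP.cov_eq g h

/-- The first coefficients of `F ∼ N(0, C)` have the law `N(0, Λ)`. -/
theorem map_coeffs_eq_tilted (hP : IsCenteredGaussian P C) (he : IsSpectralDecomposition C lam e)
    {M : ℕ} (hM : ∀ m < M, 0 < lam m) :
    P.map (coeffs e M) = (volume : Measure (EuclideanSpace ℝ (Fin M))).tilted
        (fun u => - (1 / 2 * ∑ m : Fin M, (lam m)⁻¹ * u m ^ 2)) := by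
  have := hP.gaussian
  have hMF : ∀ m : Fin M, 0 < lam m := fun m => hM m m.2
  have hcov : ∀ i j : Fin M, cov[fun f => ⟪f, e i⟫, fun f => ⟪f, e j⟫; P]
      = if i = j then lam i else 0 := by
    intro i j
    rw [hP.covariance_inner, apply_eigen he (hMF i), real_inner_smul_left,
      inner_orth he (hMF i) (hMF j)]
    simp [Fin.val_inj]
  have hG : HasGaussianLaw (fun (f : H) (m : Fin M) => ⟪f, e m⟫) P := by
    have := (IsGaussian.hasGaussianLaw_id (μ := P)).map_fun
      (ContinuousLinearMap.pi (fun m : Fin M => innerSL ℝ (e m)))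
    simpa [real_inner_comm] using! this
  -- Jointly Gaussian and pairwise uncorrelated coordinates are independent, so the joint law is a
  -- product.
  have hind : iIndepFun (fun (m : Fin M) (f : H) => ⟪f, e m⟫) P :=
    hG.iIndepFun_of_covariance_eq_zero (fun i j hij => by rw [hcov, if_neg hij])
  have hmarg : ∀ m : Fin M, P.map (fun f => ⟪f, e m⟫) = gaussianReal 0 (lam m).toNNReal := by
    intro m
    rw [IsGaussian.eq_gaussianReal _ (hG.eval m).isGaussian_map]
    congr 1
    · rw [integral_map (by fun_prop) (by fun_prop)]
      exact hP.integral_inner _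
    · rw [variance_map (by fun_prop) (by fun_prop), ← covariance_self (by fun_prop)]
      have := hcov m m
      rw [if_pos rfl] at this
      rw [← this]
      rfl
  have hpi := (iIndepFun_iff_map_fun_eq_pi_map (by fun_prop)).mp hind
  simp_rw [hmarg] at hpi
  have hv : ∀ m : Fin M, (lam m).toNNReal ≠ 0 := fun m => (Real.toNNReal_pos.mpr (hMF m)).ne'
  have h2 := map_toLp_pi_gaussianReal hv
  rw [← hpi, Measure.map_map (by fun_prop) (by fun_prop)] at h2
  simp_rw [fun m : Fin M => Real.coe_toNNReal _ (hMF m).le] at h2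
  rw [← h2]
  congr 1
  funext f
  simp [coeffs, real_inner_comm]

/-- All exponential moments of the norm under a Gaussian measure are finite. -/
theorem integrable_exp_mul_norm (P : Measure H) [IsGaussian P] (c : ℝ) :
    Integrable (fun f => Real.exp (c * ‖f‖)) P := by
  -- Fernique's theorem supplies `K`; completing the square gives `c‖f‖ ≤ K‖f‖² + c²/(4K)`.
  obtain ⟨K, hK, hint⟩ := IsGaussian.exists_integrable_exp_sq P
  refine (hint.const_mul (Real.exp (c ^ 2 / (4 * K)))).mono'
    (Measurable.aestronglyMeasurable (by fun_prop)) (ae_of_all _ fun f => ?_)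
  rw [Real.norm_eq_abs, Real.abs_exp, ← Real.exp_add]
  refine Real.exp_le_exp.mpr ?_
  have h : c ^ 2 / (4 * K) + K * ‖f‖ ^ 2 - c * ‖f‖ = (c - 2 * K * ‖f‖) ^ 2 / (4 * K) := by
    field_simp
    ring
  have : 0 ≤ (c - 2 * K * ‖f‖) ^ 2 / (4 * K) := by positivity
  linarith

end GaussianCoordinates

/-! ### Weak and Borel measurability in a separable Hilbert space. -/

section Measurability

/-- Weak measurability implies measurability in a separable Hilbert space. -/
theorem measurable_of_forall_measurable_inner {X H : Type*} [MeasurableSpace X]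
    [NormedAddCommGroup H] [InnerProductSpace ℝ H] [SecondCountableTopology H]
    [MeasurableSpace H] [BorelSpace H] {φ : X → H} (hφ : ∀ g, Measurable (fun x => ⟪φ x, g⟫)) :
    Measurable φ := by
  have hd := TopologicalSpace.denseRange_denseSeq H
  set d := TopologicalSpace.denseSeq H
  have hball : ∀ (h : H) (r : ℝ), 0 ≤ r → MeasurableSet (φ ⁻¹' Metric.closedBall h r) := by
    intro h r hr
    -- A closed ball is a countable intersection of half-spaces with normals in a dense sequence;
    -- density extends the inequality to the normal `φ x - h`, which recovers the norm.
    have heq : φ ⁻¹' Metric.closedBall h r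
        = ⋂ n : ℕ, {x | ⟪φ x, d n⟫ - ⟪h, d n⟫ ≤ r * ‖d n‖} := by
      ext x
      simp only [Set.mem_preimage, mem_closedBall_iff_norm, Set.mem_iInter, Set.mem_ofPred_eq,
        ← inner_sub_left]
      constructor
      · intro hx n
        exact (real_inner_le_norm _ _).trans (mul_le_mul_of_nonneg_right hx (norm_nonneg _))
      · intro hx
        have hcl : IsClosed {v : H | ⟪φ x - h, v⟫ ≤ r * ‖v‖} :=
          isClosed_le (by fun_prop) (by fun_prop)
        have hall : φ x - h ∈ {v : H | ⟪φ x - h, v⟫ ≤ r * ‖v‖} :=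
          hd.induction_on (p := fun v => ⟪φ x - h, v⟫ ≤ r * ‖v‖) _ hcl hx
        rw [Set.mem_ofPred_eq, real_inner_self_eq_norm_mul_norm] at hall
        by_contra! hlt
        exact absurd hall (not_le.mpr (mul_lt_mul_of_pos_right hlt (hr.trans_lt hlt)))
    rw [heq]
    exact MeasurableSet.iInter fun n => measurableSet_le ((hφ _).sub_const _) measurable_const
  refine measurable_of_isOpen (fun U hU => ?_)
  -- Open sets are countable unions of closed balls centred in the dense sequence. A radius below
  -- `ε/2`, with centre that close to `y`, keeps the ball inside the `ε`-ball of `y`.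
  have heq : U = ⋃ (p : ℕ × ℕ) (_ : Metric.closedBall (d p.1) (1 / ((p.2 : ℝ) + 1)) ⊆ U),
      Metric.closedBall (d p.1) (1 / ((p.2 : ℝ) + 1)) := by
    refine Set.Subset.antisymm (fun y hy => ?_) (Set.iUnion₂_subset fun p hp => hp)
    obtain ⟨ε, hε, hεU⟩ := Metric.isOpen_iff.mp hU y hy
    obtain ⟨k, hk⟩ := exists_nat_one_div_lt (half_pos hε)
    obtain ⟨n, hn⟩ := hd.exists_dist_lt y (ε := 1 / ((k : ℝ) + 1)) (by positivity)
    refine Set.mem_iUnion₂.mpr ⟨(n, k), fun z hz => hεU ?_, hn.le⟩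
    rw [Metric.mem_ball]
    rw [Metric.mem_closedBall] at hz
    have := dist_triangle z (d n) y
    rw [dist_comm (d n) y] at this
    simp only at hz
    linarith
  rw [heq, Set.preimage_iUnion₂]
  exact MeasurableSet.iUnion fun p => MeasurableSet.iUnion fun _ => hball _ _ (by positivity)

end Measurability

/-! ### Measurability and the covariance operator in the reproducing kernel space. -/

section ReproducingKernel

variable {X H : Type*} [NormedAddCommGroup H] [InnerProductSpace ℝ H] [CompleteSpace H]
  [RKHS ℝ H X ℝ]

theorem inner_feature (f : H) (x : X) : ⟪f, feature H x⟫ = f x := by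
  rw [feature, RKHS.inner_kerFun]
  simp

theorem feature_apply (x x' : X) : feature H x x' = kernelFun H x' x :=
  RKHS.kerFun_apply H x 1 x'

theorem kernelFun_eq_inner (x x' : X) : kernelFun H x x' = ⟪feature H x', feature H x⟫ := by
  rw [inner_feature, feature_apply]

theorem kernelFun_comm (x x' : X) : kernelFun H x x' = kernelFun H x' x := by
  rw [kernelFun_eq_inner, kernelFun_eq_inner, real_inner_comm]

theorem kernelFun_self (x : X) : kernelFun H x x = ‖feature H x‖ ^ 2 := by
  rw [kernelFun_eq_inner, real_inner_self_eq_norm_sq]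

variable [MeasurableSpace X]

/-- Kernel sections are measurable and span a dense subspace, and convergence in `H` implies
pointwise convergence. -/
theorem measurable_coe (hk : ∀ x : X, Measurable (kernelFun H x)) (f : H) :
    Measurable (fun x => f x) := by
  have hspan : ∀ g ∈ Submodule.span ℝ {h : H | ∃ (x : X) (v : ℝ), RKHS.kerFun H x v = h},
      Measurable (fun x => g x) := by
    intro g hg
    induction hg using Submodule.span_induction with
    | mem h hh =>
      obtain ⟨x, v, rfl⟩ := hh
      have : RKHS.kerFun H x v = v • feature H x := by
        rw [feature, ← map_smul]
        simp
      simp only [this, RKHS.coe_smul, Pi.smul_apply, feature_apply]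
      simp_rw [kernelFun_comm _ x]
      exact (hk x).const_smul v
    | zero => simp
    | add g h _ _ hg hh => simpa using! hg.add hh
    | smul c g _ hg => simpa using! hg.const_smul c
  have hf : f ∈ closure (Submodule.span ℝ {h : H | ∃ (x : X) (v : ℝ), RKHS.kerFun H x v = h} :
      Set H) := by
    rw [← Submodule.topologicalClosure_coe, RKHS.kerFun_dense]
    trivial
  obtain ⟨g, hg, hlim⟩ := mem_closure_iff_seq_limit.mp hf
  refine measurable_of_tendsto_metrizable (fun n => hspan (g n) (hg n)) ?_
  rw [tendsto_pi_nhds]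
  exact fun x => ((RKHS.continuous_eval x).tendsto f).comp hlim

variable [SecondCountableTopology H] [MeasurableSpace H] [BorelSpace H]

theorem measurable_feature (hk : ∀ x : X, Measurable (kernelFun H x)) :
    Measurable (feature H : X → H) := by
  refine measurable_of_forall_measurable_inner (fun g => ?_)
  simp_rw [real_inner_comm, inner_feature]
  exact measurable_coe hk g

theorem integrable_coe_smul_feature (hk : ∀ x : X, Measurable (kernelFun H x)) {ν : Measure X}
    (hν : Integrable (fun x => kernelFun H x x) ν) (f : H) :
    Integrable (fun x => f x • feature H x) ν := by
  refine (hν.const_mul ‖f‖).mono'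
    ((measurable_coe hk f).smul (measurable_feature hk)).aestronglyMeasurable
    (ae_of_all _ fun x => ?_)
  rw [norm_smul, kernelFun_self, sq, ← mul_assoc, ← inner_feature f x]
  exact mul_le_mul_of_nonneg_right (norm_inner_le_norm _ _) (norm_nonneg _)

/-- Links the inner product of `H` to that of `L²(ν)`; the trace formula and `∫ e_m² dν = λ_m` rest
on it. -/
theorem inner_covOp (hk : ∀ x : X, Measurable (kernelFun H x)) {ν : Measure X}
    (hν : Integrable (fun x => kernelFun H x x) ν) (f g : H) :
    ⟪covOp ν f, g⟫ = ∫ x, f x * g x ∂ν := by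
  rw [covOp, real_inner_comm, ← integral_inner (integrable_coe_smul_feature hk hν f)]
  simp_rw [inner_smul_right, inner_feature]

theorem integrable_coe_sq (hk : ∀ x : X, Measurable (kernelFun H x)) {ν : Measure X}
    (hν : Integrable (fun x => kernelFun H x x) ν) (f : H) :
    Integrable (fun x => f x ^ 2) ν := by
  have := (integrable_coe_smul_feature hk hν f).const_inner (𝕜 := ℝ) f
  simpa only [inner_smul_right, inner_feature, sq] using this

theorem smoothedKernel_self (hk : ∀ x : X, Measurable (kernelFun H x)) {ν : Measure X}
    (hν : Integrable (fun x => kernelFun H x x) ν) (x : X) :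
    smoothedKernel H ν x x = ⟪covOp ν (feature H x), feature H x⟫ := by
  rw [inner_covOp hk hν, smoothedKernel]
  simp_rw [feature_apply, kernelFun_comm x]

end ReproducingKernel

/-! ### Splitting off the first `M` coefficients. -/

section Residual

variable {H : Type*} [NormedAddCommGroup H] [InnerProductSpace ℝ H]

/-- The removal of the first `M` coefficients, as a continuous linear map. -/
noncomputable def residual (e : ℕ → H) (M : ℕ) : H →L[ℝ] H :=
  ContinuousLinearMap.id ℝ H - ∑ m : Fin M, (innerSL ℝ (e m)).smulRight (e m)

/-- The linear combination of the first `M` vectors `e m` with given coefficients. -/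
noncomputable def synthesis (e : ℕ → H) (M : ℕ) : EuclideanSpace ℝ (Fin M) →L[ℝ] H :=
  ∑ m : Fin M, (EuclideanSpace.proj m).smulRight (e m)

theorem residual_apply (e : ℕ → H) (M : ℕ) (f : H) :
    residual e M f = f - ∑ m : Fin M, ⟪e m, f⟫ • e m := by
  simp [residual]

theorem synthesis_apply (e : ℕ → H) {M : ℕ} (u : EuclideanSpace ℝ (Fin M)) :
    synthesis e M u = ∑ m : Fin M, u m • e m := by
  simp [synthesis]

theorem replaceCoeffs_eq (e : ℕ → H) {M : ℕ} (u : EuclideanSpace ℝ (Fin M)) (f : H) :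
    replaceCoeffs e u f = residual e M f + synthesis e M u := by
  simp only [replaceCoeffs, residual_apply, synthesis_apply, sub_smul, Finset.sum_sub_distrib]
  abel

/-- Self-adjointness moves the residual map from the random function onto a fixed feature vector,
where the covariance identity applies. -/
theorem inner_residual_comm (e : ℕ → H) (M : ℕ) (f g : H) :
    ⟪residual e M f, g⟫ = ⟪f, residual e M g⟫ := by
  simp only [residual_apply, inner_sub_left, inner_sub_right, sum_inner, inner_sum,
    real_inner_smul_left, real_inner_smul_right]
  congr 1
  refine Finset.sum_congr rfl (fun m _ => ?_)
  rw [real_inner_comm f (e m), mul_comm, real_inner_comm]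

variable {C : H → H} {lam : ℕ → ℝ} {e : ℕ → H}

theorem inner_residual_of_lt (he : IsSpectralDecomposition C lam e) {M : ℕ}
    (hM : ∀ m < M, 0 < lam m) {j : ℕ} (hj : j < M) (g : H) : ⟪e j, residual e M g⟫ = 0 := by
  simp only [residual_apply, inner_sub_right, inner_sum, inner_smul_right]
  rw [Finset.sum_eq_single (⟨j, hj⟩ : Fin M)]
  · rw [inner_orth he (hM j hj) (hM j hj), if_pos rfl]
    ring
  · intro i _ hi
    rw [inner_orth he (hM j hj) (hM i i.2), if_neg (fun h => hi (Fin.ext h.symm)), mul_zero]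
  · simp

theorem inner_residual_of_ge (he : IsSpectralDecomposition C lam e) {M : ℕ}
    (hM : ∀ m < M, 0 < lam m) {j : ℕ} (hj : M ≤ j) (hlam : 0 < lam j) (g : H) :
    ⟪e j, residual e M g⟫ = ⟪e j, g⟫ := by
  simp only [residual_apply, inner_sub_right, inner_sum, inner_smul_right]
  rw [Finset.sum_eq_zero, sub_zero]
  intro i _
  rw [inner_orth he hlam (hM i i.2), if_neg (by have := i.2; omega), mul_zero]

theorem IsSpectralDecomposition.hasSum_inner (he : IsSpectralDecomposition C lam e) (f : H) :
    HasSum (fun m => lam m * ⟪e m, f⟫ ^ 2) ⟪C f, f⟫ := by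
  have := (he.hasSum f).mapL (innerSL ℝ f)
  simp only [innerSL_apply_apply, inner_smul_right] at this
  have hsq : ∀ m, lam m * ⟪e m, f⟫ ^ 2 = lam m * ⟪e m, f⟫ * ⟪f, e m⟫ := fun m => by
    rw [real_inner_comm (e m) f]
    ring
  rw [real_inner_comm]
  simpa only [hsq] using this

theorem IsSpectralDecomposition.hasSum_inner_tail (he : IsSpectralDecomposition C lam e) (M : ℕ)
    (f : H) : HasSum (fun m => lam (M + m) * ⟪e (M + m), f⟫ ^ 2)
      (⟪C f, f⟫ - ∑ m : Fin M, lam m * ⟪e m, f⟫ ^ 2) := by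
  have := (hasSum_nat_add_iff' M).mpr (he.hasSum_inner f)
  rw [Finset.sum_range] at this
  simpa only [add_comm M] using this

/-- Both sides are the tail of the spectral series: the residual map kills the first `M`
coefficients and keeps every later one of positive eigenvalue. -/
theorem inner_cov_residual (he : IsSpectralDecomposition C lam e) {M : ℕ}
    (hM : ∀ m < M, 0 < lam m) (f : H) : ⟪C (residual e M f), residual e M f⟫
      = ⟪C f, f⟫ - ∑ m : Fin M, lam m * ⟪e m, f⟫ ^ 2 := by
  refine (he.hasSum_inner_tail M f).unique ?_ |>.symm
  have := he.hasSum_inner_tail M (residual e M f)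
  rw [Finset.sum_eq_zero (fun m _ => by rw [inner_residual_of_lt he hM m.2]; ring),
    sub_zero] at this
  convert this using 2 with m
  -- The vectors of zero eigenvalue are arbitrary, but their weight vanishes.
  rcases (he.nonneg (M + m)).eq_or_lt with h | h
  · simp [← h]
  · rw [inner_residual_of_ge he hM (Nat.le_add_right M m) h]

theorem coeffs_replaceCoeffs (he : IsSpectralDecomposition C lam e) {M : ℕ}
    (hM : ∀ m < M, 0 < lam m) (u : EuclideanSpace ℝ (Fin M)) (f : H) :
    coeffs e M (replaceCoeffs e u f) = u := by
  ext j
  simp only [coeffs, replaceCoeffs_eq, inner_add_right, inner_residual_of_lt he hM j.2,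
    synthesis_apply, inner_sum, inner_smul_right, zero_add]
  rw [Finset.sum_eq_single j]
  · rw [inner_orth he (hM j j.2) (hM j j.2), if_pos rfl, mul_one]
  · intro i _ hi
    rw [inner_orth he (hM j j.2) (hM i i.2), if_neg (fun h => hi (Fin.ext h.symm)), mul_zero]
  · simp

end Residual

/-! ### The trace of the residual covariance, for fixed and for random inputs. -/

section ResidualCovariance

variable {X H : Type*} [NormedAddCommGroup H] [InnerProductSpace ℝ H] [CompleteSpace H]
  [RKHS ℝ H X ℝ] [MeasurableSpace X] [SecondCountableTopology H] [MeasurableSpace H] [BorelSpace H]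
  {ν : Measure X} {P : Measure H} {lam : ℕ → ℝ} {e : ℕ → H} {M N : ℕ}

theorem trace_residualCov (hk : ∀ x : X, Measurable (kernelFun H x))
    (hν : Integrable (fun x => kernelFun H x x) ν) (x : Fin N → X) :
    (residualCov ν lam e M x).trace
      = ∑ n, (⟪covOp ν (feature H (x n)), feature H (x n)⟫
        - ∑ m : Fin M, lam m * ⟪e m, feature H (x n)⟫ ^ 2) := by
  rw [Matrix.trace]
  refine Finset.sum_congr rfl (fun n _ => ?_)
  simp only [residualCov, Matrix.diag_apply, Matrix.sub_apply, Matrix.of_apply,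
    smoothedKernel_self hk hν, Matrix.mul_apply (M := _ * _), Matrix.mul_diagonal,
    Matrix.transpose_apply]
  congr 1
  refine Finset.sum_congr rfl (fun m _ => ?_)
  rw [inner_feature]
  ring

theorem hasSum_trace_residualCov (hk : ∀ x : X, Measurable (kernelFun H x))
    (hν : Integrable (fun x => kernelFun H x x) ν)
    (he : IsSpectralDecomposition (covOp ν : H → H) lam e) (x : Fin N → X) :
    HasSum (fun m => lam (M + m) * ∑ n, (e (M + m) (x n)) ^ 2)
      (residualCov ν lam e M x).trace := by
  rw [trace_residualCov hk hν]
  have := hasSum_sum (s := Finset.univ)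
    (fun (n : Fin N) _ => he.hasSum_inner_tail M (feature H (x n)))
  simpa only [inner_feature, ← Finset.mul_sum] using this

/-- Each `(RF)(x_n)`, with `R` the residual map, is the inner product of `F` with `R k(·, x_n)`, and
its variance is the `n`-th diagonal entry of `Σ`. -/
theorem integral_norm_sq_evalAt_residual (hk : ∀ x : X, Measurable (kernelFun H x))
    (hν : Integrable (fun x => kernelFun H x x) ν) (hP : IsCenteredGaussian P (covOp ν))
    (he : IsSpectralDecomposition (covOp ν : H → H) lam e) (hM : ∀ m < M, 0 < lam m)
    (x : Fin N → X) :
    ∫ f, ‖evalAt x (residual e M f)‖ ^ 2 ∂P = (residualCov ν lam e M x).trace := by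
  rw [trace_residualCov hk hν]
  simp_rw [EuclideanSpace.norm_sq_eq, evalAt, ← inner_feature, inner_residual_comm, Real.norm_eq_abs,
    sq_abs]
  rw [integral_finsetSum _ (fun n _ => (hP.memLp_inner _).integrable_sq)]
  refine Finset.sum_congr rfl (fun n _ => ?_)
  rw [← inner_cov_residual he hM, ← hP.cov_eq]
  simp_rw [sq]

theorem integral_coe_sq_eigen (hk : ∀ x : X, Measurable (kernelFun H x))
    (hν : Integrable (fun x => kernelFun H x x) ν)
    (he : IsSpectralDecomposition (covOp ν : H → H) lam e) {m : ℕ} (hm : 0 < lam m) :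
    ∫ x, e m x ^ 2 ∂ν = lam m := by
  have := inner_covOp hk hν (e m) (e m)
  rw [apply_eigen he hm, real_inner_smul_left, inner_orth he hm hm, if_pos rfl, mul_one] at this
  simp_rw [sq]
  exact this.symm

theorem lintegral_eigen_mul_coe_sq (hk : ∀ x : X, Measurable (kernelFun H x))
    (hν : Integrable (fun x => kernelFun H x x) ν)
    (he : IsSpectralDecomposition (covOp ν : H → H) lam e) (m : ℕ) :
    ∫⁻ x, ENNReal.ofReal (lam m * e m x ^ 2) ∂ν = ENNReal.ofReal (lam m ^ 2) := by
  rcases (he.nonneg m).eq_or_lt with h | h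
  · simp [← h]
  · rw [← ofReal_integral_eq_lintegral_ofReal ((integrable_coe_sq hk hν (e m)).const_mul _)
      (ae_of_all _ fun x => by positivity), integral_const_mul, integral_coe_sq_eigen hk hν he h,
      sq]

/-- Bessel's inequality for the feature of `x` gives `∑ e_m(x)² ≤ k(x, x)` over positive
eigenvalues. Integrating shows that `C` has finite trace, and `λ_m² ≤ λ_0 λ_m`. -/
theorem summable_eigen_sq (hk : ∀ x : X, Measurable (kernelFun H x))
    (hν : Integrable (fun x => kernelFun H x x) ν)
    (he : IsSpectralDecomposition (covOp ν : H → H) lam e) : Summable (fun m => lam m ^ 2) := by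
  have hsum : Summable lam := by
    refine summable_of_sum_le he.nonneg (c := ∫ x, kernelFun H x x ∂ν) (fun s => ?_)
    classical
    have hs : ∑ m ∈ s, lam m = ∑ m ∈ s.filter (fun m => 0 < lam m), lam m := by
      rw [Finset.sum_filter]
      refine Finset.sum_congr rfl (fun m _ => ?_)
      split_ifs with h
      · rfl
      · exact le_antisymm (not_lt.mp h) (he.nonneg m)
    have hs2 : ∑ m ∈ s.filter (fun m => 0 < lam m), lam m
        = ∫ x, ∑ m ∈ s.filter (fun m => 0 < lam m), e m x ^ 2 ∂ν := by
      rw [integral_finsetSum _ (fun m _ => integrable_coe_sq hk hν (e m))]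
      exact Finset.sum_congr rfl
        (fun m hm => (integral_coe_sq_eigen hk hν he (Finset.mem_filter.mp hm).2).symm)
    rw [hs, hs2]
    refine integral_mono (integrable_finsetSum _ (fun m _ => integrable_coe_sq hk hν (e m))) hν
      (fun x => ?_)
    have hb := he.orthonormal.sum_inner_products_le (feature H x)
      (s := (s.filter (fun m => 0 < lam m)).subtype (fun m => 0 < lam m))
    simp only [inner_feature, Real.norm_eq_abs, sq_abs] at hb
    rw [Finset.sum_subtype_of_mem (fun m => e m x ^ 2)
      (fun m hm => (Finset.mem_filter.mp hm).2)] at hb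
    simpa only [kernelFun_self] using hb
  refine (hsum.mul_left (lam 0)).of_nonneg_of_le (fun m => sq_nonneg _) (fun m => ?_)
  rw [sq]
  exact mul_le_mul_of_nonneg_right (he.antitone (Nat.zero_le m)) (he.nonneg m)

/-- The expected trace of the residual covariance under independent inputs. -/
theorem lintegral_trace_residualCov (hk : ∀ x : X, Measurable (kernelFun H x))
    [IsProbabilityMeasure ν] (hν : Integrable (fun x => kernelFun H x x) ν)
    (he : IsSpectralDecomposition (covOp ν : H → H) lam e) :
    ∫⁻ x, ENNReal.ofReal (residualCov ν lam e M x).trace ∂(Measure.pi (fun _ : Fin N => ν))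
      = ENNReal.ofReal (N * ∑' m, lam (M + m) ^ 2) := by
  have hsq : Summable (fun m => lam (M + m) ^ 2) := by
    simpa only [add_comm M] using (summable_nat_add_iff M).mpr (summable_eigen_sq hk hν he)
  have hpt : ∀ x : Fin N → X, ENNReal.ofReal (residualCov ν lam e M x).trace
      = ∑' m, ∑ n, ENNReal.ofReal (lam (M + m) * e (M + m) (x n) ^ 2) := by
    intro x
    have h := hasSum_trace_residualCov (M := M) hk hν he x
    have hnn : ∀ m n, 0 ≤ lam (M + m) * e (M + m) (x n) ^ 2 :=
      fun m n => mul_nonneg (he.nonneg _) (sq_nonneg _)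
    rw [← h.tsum_eq, ENNReal.ofReal_tsum_of_nonneg (fun m =>
      mul_nonneg (he.nonneg _) (Finset.sum_nonneg fun n _ => sq_nonneg _)) h.summable]
    refine tsum_congr (fun m => ?_)
    rw [Finset.mul_sum, ENNReal.ofReal_sum_of_nonneg (fun n _ => hnn m n)]
  have hmeas : ∀ m, Measurable (fun y : X => ENNReal.ofReal (lam m * e m y ^ 2)) := fun m =>
    (((measurable_coe hk (e m)).pow_const 2).const_mul _).ennreal_ofReal
  simp_rw [hpt]
  have hmeas' : ∀ m n, Measurable (fun x : Fin N → X => ENNReal.ofReal (lam m * e m (x n) ^ 2)) :=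
    fun m n => (hmeas m).comp (measurable_pi_apply n)
  -- Nonnegativity permits exchanging the series with the integral; each input then contributes
  -- through its marginal `ν`.
  rw [lintegral_tsum (fun m => (Finset.measurable_fun_sum _ fun n _ => hmeas' _ n).aemeasurable)]
  have hterm : ∀ m, ∫⁻ x, ∑ n, ENNReal.ofReal (lam (M + m) * e (M + m) (x n) ^ 2)
      ∂(Measure.pi (fun _ : Fin N => ν)) = N * ENNReal.ofReal (lam (M + m) ^ 2) := by
    intro m
    rw [lintegral_finsetSum _ (fun n _ => hmeas' _ n)]
    rw [Finset.sum_congr rfl (fun n _ =>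
      ((measurePreserving_eval (fun _ : Fin N => ν) n).lintegral_comp (hmeas (M + m))).trans
        (lintegral_eigen_mul_coe_sq hk hν he (M + m)))]
    simp
  simp_rw [hterm]
  rw [ENNReal.tsum_mul_left, ENNReal.ofReal_mul (Nat.cast_nonneg N), ENNReal.ofReal_natCast,
    ENNReal.ofReal_tsum_of_nonneg (fun m => sq_nonneg _) hsq]

end ResidualCovariance

/-! ### Linear growth and integrability under tilted Gaussian measures. -/

section LinearGrowth

/-- The function `a` is bounded in absolute value by an affine function of the norm. -/
def HasLinearGrowth {E : Type*} [Norm E] (a : E → ℝ) : Prop :=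
  ∃ A B : ℝ, ∀ f, |a f| ≤ A + B * ‖f‖

theorem HasLinearGrowth.neg {E : Type*} [Norm E] {a : E → ℝ} (ha : HasLinearGrowth a) :
    HasLinearGrowth (fun f => - a f) := by
  simpa only [HasLinearGrowth, abs_neg] using ha

theorem HasLinearGrowth.comp_clm {E F : Type*} [NormedAddCommGroup E] [NormedSpace ℝ E]
    [NormedAddCommGroup F] [NormedSpace ℝ F] {a : F → ℝ} (ha : HasLinearGrowth a) (T : E →L[ℝ] F) :
    HasLinearGrowth (fun f => a (T f)) := by
  obtain ⟨A, B, h⟩ := ha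
  refine ⟨A, |B| * ‖T‖, fun f => (h _).trans ?_⟩
  have h1 : B * ‖T f‖ ≤ |B| * ‖T f‖ := mul_le_mul_of_nonneg_right (le_abs_self B) (norm_nonneg _)
  have h2 : |B| * ‖T f‖ ≤ |B| * (‖T‖ * ‖f‖) :=
    mul_le_mul_of_nonneg_left (T.le_opNorm f) (abs_nonneg B)
  linarith

theorem hasLinearGrowth_of_lipschitzWith {E : Type*} [NormedAddCommGroup E] {l : E → ℝ} {κ : ℝ≥0}
    (hl : LipschitzWith κ l) : HasLinearGrowth l := by
  refine ⟨|l 0|, κ, fun v => ?_⟩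
  have h := hl.dist_le_mul v 0
  rw [Real.dist_eq, dist_zero_right] at h
  have h2 : |l v| ≤ |l v - l 0| + |l 0| := by
    simpa using abs_add_le (l v - l 0) (l 0)
  linarith

theorem HasLinearGrowth.integrable {E : Type*} [NormedAddCommGroup E] [MeasurableSpace E]
    {τ : Measure E} [IsFiniteMeasure τ] {a : E → ℝ} (ha : HasLinearGrowth a) (ham : Measurable a)
    (hτ : Integrable (fun u => ‖u‖) τ) : Integrable a τ := by
  obtain ⟨A, B, h⟩ := ha
  exact ((integrable_const A).add (hτ.const_mul B)).mono' ham.aestronglyMeasurable (ae_of_all _ h)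

variable {H : Type*} [NormedAddCommGroup H] [InnerProductSpace ℝ H] [CompleteSpace H]
  [SecondCountableTopology H] [MeasurableSpace H] [BorelSpace H]
  {P : Measure H} [IsGaussian P] {a b : H → ℝ}

theorem HasLinearGrowth.integrable_exp (ha : HasLinearGrowth a) (ham : Measurable a) :
    Integrable (fun f => Real.exp (a f)) P := by
  obtain ⟨A, B, h⟩ := ha
  refine ((integrable_exp_mul_norm P B).const_mul (Real.exp A)).mono'
    ham.exp.aestronglyMeasurable (ae_of_all _ fun f => ?_)
  rw [Real.norm_eq_abs, Real.abs_exp, ← Real.exp_add]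
  exact Real.exp_le_exp.mpr ((le_abs_self _).trans (h f))

/-- The tilt density times `b` is still at most exponential in the norm, and a Gaussian measure has
all such moments. -/
theorem HasLinearGrowth.integrable_tilted_of_le_exp (ha : HasLinearGrowth a) (ham : Measurable a)
    (hbm : Measurable b) {A B : ℝ} (hb : ∀ f, |b f| ≤ Real.exp (A + B * ‖f‖)) :
    Integrable b (P.tilted a) := by
  rw [integrable_tilted_iff (ha.integrable_exp ham)]
  obtain ⟨A', B', h⟩ := ha
  refine ((integrable_exp_mul_norm P (B' + B)).const_mul (Real.exp (A' + A))).mono'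
    (ham.exp.smul hbm).aestronglyMeasurable (ae_of_all _ fun f => ?_)
  rw [norm_smul, Real.norm_eq_abs, Real.abs_exp, Real.norm_eq_abs, ← Real.exp_add]
  calc Real.exp (a f) * |b f|
      ≤ Real.exp (A' + B' * ‖f‖) * Real.exp (A + B * ‖f‖) :=
        mul_le_mul (Real.exp_le_exp.mpr ((le_abs_self _).trans (h f))) (hb f) (abs_nonneg _)
          (Real.exp_pos _).le
    _ = Real.exp (A' + A + (B' + B) * ‖f‖) := by
        rw [← Real.exp_add]
        ring_nf

theorem HasLinearGrowth.integrable_tilted (ha : HasLinearGrowth a) (ham : Measurable a)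
    (hb : HasLinearGrowth b) (hbm : Measurable b) : Integrable b (P.tilted a) := by
  obtain ⟨A, B, h⟩ := hb
  exact ha.integrable_tilted_of_le_exp ham hbm
    (fun f => (h f).trans (by linarith [Real.add_one_le_exp (A + B * ‖f‖)]))

end LinearGrowth

/-! ### Mixtures of conditional laws. -/

section Mixture

variable {H : Type*} [NormedAddCommGroup H] [InnerProductSpace ℝ H]

/-- The coefficient map as a continuous linear map. -/
noncomputable def coeffsCLM (e : ℕ → H) (M : ℕ) : H →L[ℝ] EuclideanSpace ℝ (Fin M) :=
  (PiLp.continuousLinearEquiv 2 ℝ (fun _ : Fin M => ℝ)).symm.toContinuousLinearMap ∘L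
    ContinuousLinearMap.pi (fun m : Fin M => innerSL ℝ (e m))

variable [MeasurableSpace H]
  [BorelSpace H] [SecondCountableTopology H] {P : Measure H} [IsProbabilityMeasure P]
  {e : ℕ → H} {M : ℕ}

theorem mixture_eq_map (τ : Measure (EuclideanSpace ℝ (Fin M))) [SFinite τ] :
    mixture P e τ = (τ.prod P).map (fun q => replaceCoeffs e q.1 q.2) := by
  have hm := measurable_replaceCoeffs e M
  ext s hs
  rw [mixture, Measure.bind_apply hs (Kernel.aemeasurable _), Measure.map_apply hm hs,
    Measure.prod_apply (hm hs)]
  refine lintegral_congr (fun u => ?_)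
  have hmu : Measurable (replaceCoeffs e u) := hm.comp measurable_prodMk_left
  rw [condLaw_apply, Measure.map_apply hmu hs]
  rfl

/-- Tilting the mixing measure `N(0, Λ)` tilts the prior. -/
theorem mixture_map_coeffs_tilted [CompleteSpace H] {C : H → H} {lam : ℕ → ℝ}
    (hP : IsCenteredGaussian P C) (he : IsSpectralDecomposition C lam e) (hM : ∀ m < M, 0 < lam m)
    {h : EuclideanSpace ℝ (Fin M) → ℝ} (hh : Measurable h) :
    mixture P e ((P.map (coeffs e M)).tilted h) = P.tilted (fun f => h (coeffs e M f)) := by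
  have hmc := measurable_coeffs e M
  have hmr := measurable_replaceCoeffs e M
  have : IsMarkovKernel (condLaw P e M) := Kernel.IsMarkovKernel.map _ hmr
  have : IsProbabilityMeasure (P.map (coeffs e M)) :=
    Measure.isProbabilityMeasure_map hmc.aemeasurable
  ext s hs
  set Z := ∫ u, Real.exp (h u) ∂(P.map (coeffs e M)) with hZ
  have hZ' : ∫ f, Real.exp (h (coeffs e M f)) ∂P = Z := by
    rw [hZ, integral_map hmc.aemeasurable hh.exp.aestronglyMeasurable]
  -- The tilt density depends on the coefficients alone, so integrating `w` through the
  -- disintegration `compProd_condLaw` carries it from the mixing law to the prior.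
  let w : EuclideanSpace ℝ (Fin M) × H → ℝ≥0∞ := fun q =>
    ENNReal.ofReal (Real.exp (h q.1) / Z) * s.indicator 1 q.2
  have hw : Measurable w := by
    refine Measurable.mul (by fun_prop) ((measurable_one.indicator hs).comp measurable_snd)
  calc mixture P e ((P.map (coeffs e M)).tilted h) s
      = ∫⁻ u, ∫⁻ f, w (u, f) ∂(condLaw P e M u) ∂(P.map (coeffs e M)) := by
        rw [mixture, Measure.bind_apply hs (Kernel.aemeasurable _), lintegral_tilted]
        refine lintegral_congr (fun u => ?_)
        change _ = ∫⁻ f, ENNReal.ofReal (Real.exp (h u) / Z) * s.indicator 1 f ∂(condLaw P e M u)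
        rw [lintegral_const_mul _ (measurable_one.indicator hs), lintegral_indicator_one hs]
    _ = ∫⁻ f, w (coeffs e M f, f) ∂P := by
        rw [← Measure.lintegral_compProd hw, compProd_condLaw hP he hM,
          lintegral_map hw (by exact hmc.prodMk measurable_id)]
    _ = P.tilted (fun f => h (coeffs e M f)) s := by
        rw [tilted_apply' _ _ hs, hZ', ← lintegral_indicator hs]
        refine lintegral_congr (fun f => ?_)
        by_cases hf : f ∈ s <;> simp [w, hf]

/-- Allows moments of a mixing law to be computed under its mixture. -/
theorem map_coeffs_mixture {C : H → H} {lam : ℕ → ℝ}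
    (he : IsSpectralDecomposition C lam e) (hM : ∀ m < M, 0 < lam m)
    (τ : Measure (EuclideanSpace ℝ (Fin M))) [SFinite τ] :
    (mixture P e τ).map (coeffs e M) = τ := by
  rw [mixture_eq_map, Measure.map_map (measurable_coeffs e M) (measurable_replaceCoeffs e M)]
  have : coeffs e M ∘ (fun q : EuclideanSpace ℝ (Fin M) × H => replaceCoeffs e q.1 q.2)
      = Prod.fst := by
    funext q
    exact coeffs_replaceCoeffs he hM q.1 q.2
  rw [this]
  exact Measure.fst_prod

end Mixture

/-! ### The conditional mean loss and its distance from the loss at the mean. -/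

section Evaluation

variable {X H : Type*} [NormedAddCommGroup H] [InnerProductSpace ℝ H] [RKHS ℝ H X ℝ] {M N : ℕ}

/-- The evaluation at finitely many points as a continuous linear map. -/
noncomputable def evalCLM (H : Type*) [NormedAddCommGroup H] [InnerProductSpace ℝ H]
    [RKHS ℝ H X ℝ] (x : Fin N → X) : H →L[ℝ] EuclideanSpace ℝ (Fin N) :=
  (PiLp.continuousLinearEquiv 2 ℝ (fun _ : Fin N => ℝ)).symm.toContinuousLinearMap ∘L
    ContinuousLinearMap.pi (fun n => ContinuousLinearMap.proj (x n) ∘L RKHS.coeCLM ℝ)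

theorem evalCLM_apply (x : Fin N → X) (f : H) : evalCLM H x f = evalAt x f := rfl

theorem projMean_eq (e : ℕ → H) (x : Fin N → X) (u : EuclideanSpace ℝ (Fin M)) :
    projMean e x u = evalAt x (synthesis e M u) := by
  rw [← evalCLM_apply, synthesis_apply, map_sum]
  ext n
  simp [projMean, evalCLM_apply, evalAt]

/-- The mean loss `u ↦ 𝔼[ℓ(F(x_{1:N})) | F^{1:M} = u]`. -/
noncomputable def meanLoss [MeasurableSpace H] (P : Measure H) (e : ℕ → H) (M : ℕ)
    (l : EuclideanSpace ℝ (Fin N) → ℝ) (x : Fin N → X) (u : EuclideanSpace ℝ (Fin M)) : ℝ :=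
  ∫ f, l (evalAt x (replaceCoeffs e u f)) ∂P

theorem evalAt_replaceCoeffs (e : ℕ → H) (x : Fin N → X) (u : EuclideanSpace ℝ (Fin M)) (f : H) :
    evalAt x (replaceCoeffs e u f) = evalAt x (residual e M f) + projMean e x u := by
  rw [projMean_eq, replaceCoeffs_eq, ← evalCLM_apply, map_add]
  rfl

variable {l : EuclideanSpace ℝ (Fin N) → ℝ} {κ : ℝ≥0}

/-- The loss is dominated jointly in the coefficients and in the function. -/
theorem exists_abs_loss_le (hLip : LipschitzWith κ l) (e : ℕ → H) (M : ℕ) (x : Fin N → X) :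
    ∃ A B : ℝ, ∀ (u : EuclideanSpace ℝ (Fin M)) (f : H),
      |l (evalAt x (replaceCoeffs e u f))| ≤ A + B * ‖u‖ + B * ‖f‖ := by
  obtain ⟨A, B, h⟩ := (hasLinearGrowth_of_lipschitzWith hLip).comp_clm
    (evalCLM H x ∘L (residual e M ∘L ContinuousLinearMap.snd ℝ _ _
      + synthesis e M ∘L ContinuousLinearMap.fst ℝ _ _))
  refine ⟨A, |B|, fun u f => ?_⟩
  have h1 := h (u, f)
  simp only [ContinuousLinearMap.comp_apply, add_apply,
    ContinuousLinearMap.coe_fst', ContinuousLinearMap.coe_snd', ← replaceCoeffs_eq,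
    evalCLM_apply] at h1
  refine h1.trans ?_
  have h2 : B * ‖(u, f)‖ ≤ |B| * (‖u‖ + ‖f‖) := by
    refine mul_le_mul (le_abs_self B) ?_ (norm_nonneg _) (abs_nonneg B)
    rw [Prod.norm_mk]
    exact max_le_add_of_nonneg (norm_nonneg _) (norm_nonneg _)
  linarith

variable [MeasurableSpace H] [BorelSpace H]

theorem measurable_evalAt (x : Fin N → X) : Measurable (evalAt x : H → _) :=
  (evalCLM H x).continuous.measurable

variable [SecondCountableTopology H]

theorem measurable_loss (hLip : LipschitzWith κ l) (e : ℕ → H) (M : ℕ) (x : Fin N → X) :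
    Measurable (fun q : EuclideanSpace ℝ (Fin M) × H => l (evalAt x (replaceCoeffs e q.1 q.2))) :=
  hLip.continuous.measurable.comp ((measurable_evalAt x).comp (measurable_replaceCoeffs e M))

theorem measurable_meanLoss {P : Measure H} [SFinite P] {e : ℕ → H} (hLip : LipschitzWith κ l) (x : Fin N → X) :
    Measurable (meanLoss P e M l x) :=
  (measurable_loss hLip e M x).stronglyMeasurable.integral_prod_right'.measurable

variable [CompleteSpace H] {P : Measure H} {e : ℕ → H}

theorem integrable_loss [IsGaussian P] (hLip : LipschitzWith κ l)
    {τ : Measure (EuclideanSpace ℝ (Fin M))} [IsProbabilityMeasure τ]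
    (hτ : Integrable (fun u => ‖u‖) τ) (x : Fin N → X) :
    Integrable (fun q : EuclideanSpace ℝ (Fin M) × H => l (evalAt x (replaceCoeffs e q.1 q.2)))
      (τ.prod P) := by
  obtain ⟨A, B, h⟩ := exists_abs_loss_le hLip e M x
  have hf : Integrable (fun f : H => ‖f‖) P := (IsGaussian.integrable_id (μ := P)).norm
  exact (((integrable_const A).add ((hτ.comp_fst P).const_mul B)).add
    ((hf.comp_snd τ).const_mul B)).mono' (measurable_loss hLip e M x).aestronglyMeasurable
    (ae_of_all _ fun q => h q.1 q.2)

theorem integrable_loss_right [IsGaussian P] (hLip : LipschitzWith κ l) (x : Fin N → X)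
    (u : EuclideanSpace ℝ (Fin M)) :
    Integrable (fun f => l (evalAt x (replaceCoeffs e u f))) P := by
  obtain ⟨A, B, h⟩ := exists_abs_loss_le hLip e M x
  have hf : Integrable (fun f : H => ‖f‖) P := (IsGaussian.integrable_id (μ := P)).norm
  exact ((integrable_const (A + B * ‖u‖)).add (hf.const_mul B)).mono'
    ((measurable_loss hLip e M x).comp measurable_prodMk_left).aestronglyMeasurable
    (ae_of_all _ fun f => h u f)

theorem hasLinearGrowth_meanLoss [IsGaussian P] (hLip : LipschitzWith κ l) (x : Fin N → X) :
    HasLinearGrowth (meanLoss P e M l x) := by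
  obtain ⟨A, B, h⟩ := exists_abs_loss_le hLip e M x
  have hf : Integrable (fun f : H => ‖f‖) P := (IsGaussian.integrable_id (μ := P)).norm
  refine ⟨A + B * ∫ f, ‖f‖ ∂P, B, fun u => ?_⟩
  calc |meanLoss P e M l x u| ≤ ∫ f, |l (evalAt x (replaceCoeffs e u f))| ∂P :=
        abs_integral_le_integral_abs
    _ ≤ ∫ f, (A + B * ‖u‖ + B * ‖f‖) ∂P :=
        integral_mono (integrable_loss_right hLip x u).abs
          ((integrable_const _).add (hf.const_mul B)) (h u)
    _ = A + B * ∫ f, ‖f‖ ∂P + B * ‖u‖ := by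
        rw [integral_add (integrable_const _) (hf.const_mul B), integral_const_mul]
        simp only [integral_const, probReal_univ, smul_eq_mul, one_mul]
        ring

variable {C : H → H} {lam : ℕ → ℝ}

/-- Convexity: the mean loss dominates the loss at the mean. -/
theorem loss_projMean_le_meanLoss (hP : IsCenteredGaussian P C) (hLip : LipschitzWith κ l)
    (hconv : ConvexOn ℝ Set.univ l) (x : Fin N → X) (u : EuclideanSpace ℝ (Fin M)) :
    l (projMean e x u) ≤ meanLoss P e M l x u := by
  have := hP.gaussian
  have hid : Integrable (fun f : H => f) P := IsGaussian.integrable_id (μ := P)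
  let T := evalCLM H x ∘L residual e M
  have hT : Integrable (fun f => T f) P := T.integrable_comp hid
  have hint : Integrable (fun f => evalAt x (replaceCoeffs e u f)) P := by
    simp_rw [evalAt_replaceCoeffs]
    exact hT.add (integrable_const _)
  have hmean : ∫ f, evalAt x (replaceCoeffs e u f) ∂P = projMean e x u := by
    simp_rw [evalAt_replaceCoeffs]
    rw [integral_add (by exact hT) (integrable_const _)]
    have h0 : ∫ f, evalAt x (residual e M f) ∂P = 0 := by
      have := T.integral_comp_comm hid
      rw [hP.mean_eq, map_zero] at this
      exact this
    rw [h0]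
    simp
  -- Jensen's inequality; the residual is centred, so the mean of the evaluations is `projMean e x
  -- u`.
  have := hconv.map_integral_le (μ := P) hLip.continuous.continuousOn isClosed_univ
    (ae_of_all _ fun _ => Set.mem_univ _) hint (integrable_loss_right hLip x u)
  rwa [hmean] at this

/-- The Lipschitz condition bounds the gap by `κ` times the mean norm of the residual evaluations,
whose law does not involve `u`. -/
theorem meanLoss_sub_loss_projMean_le (hP : IsCenteredGaussian P C) (hLip : LipschitzWith κ l)
    (x : Fin N → X) (u : EuclideanSpace ℝ (Fin M)) :
    meanLoss P e M l x u - l (projMean e x u)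
      ≤ κ * √(∫ f, ‖evalAt x (residual e M f)‖ ^ 2 ∂P) := by
  have := hP.gaussian
  let T := evalCLM H x ∘L residual e M
  have hT2 : MemLp (fun f => ‖T f‖) 2 P :=
    (T.comp_memLp' (IsGaussian.memLp_two_id (μ := P))).norm
  have hT : Integrable (fun f => ‖T f‖) P := hT2.integrable (by norm_num)
  have h1 : meanLoss P e M l x u - l (projMean e x u) ≤ κ * ∫ f, ‖T f‖ ∂P := by
    rw [← integral_const_mul, meanLoss]
    have hc : l (projMean e x u) = ∫ _f, l (projMean e x u) ∂P := by simp
    rw [hc, ← integral_sub (integrable_loss_right hLip x u) (integrable_const _)]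
    refine integral_mono ((integrable_loss_right hLip x u).sub (integrable_const _))
      (hT.const_mul _) (fun f => ?_)
    have := hLip.dist_le_mul (evalAt x (replaceCoeffs e u f)) (projMean e x u)
    rw [evalAt_replaceCoeffs, Real.dist_eq, dist_eq_norm, add_sub_cancel_right] at this
    simp only [evalAt_replaceCoeffs]
    exact (le_abs_self _).trans this
  refine h1.trans (mul_le_mul_of_nonneg_left (Real.le_sqrt_of_sq_le ?_) κ.coe_nonneg)
  -- Nonnegative variance is the required form of Cauchy-Schwarz, `(E‖T F‖)² ≤ E‖T F‖²`.
  have hvar := variance_nonneg (fun f => ‖T f‖) P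
  rw [variance_eq_sub hT2] at hvar
  have : ∫ f, ‖T f‖ ^ 2 ∂P = ∫ f, ‖evalAt x (residual e M f)‖ ^ 2 ∂P := rfl
  rw [← this]
  simpa using hvar

end Evaluation

/-! ### Both measures as tilts of the prior, and their divergence. -/

section Approximation

variable {X H : Type*} [NormedAddCommGroup H] [InnerProductSpace ℝ H] {M N : ℕ}
  {e : ℕ → H} {l : EuclideanSpace ℝ (Fin N) → ℝ} {κ : ℝ≥0} {C : H → H}
  {lam : ℕ → ℝ}

theorem HasLinearGrowth.comp_coeffs {a : EuclideanSpace ℝ (Fin M) → ℝ} (ha : HasLinearGrowth a) :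
    HasLinearGrowth (fun f => a (coeffs e M f)) :=
  ha.comp_clm (coeffsCLM e M)

variable [RKHS ℝ H X ℝ]

theorem hasLinearGrowth_projMean (hLip : LipschitzWith κ l) (e : ℕ → H) (M : ℕ) (x : Fin N → X) :
    HasLinearGrowth (fun u : EuclideanSpace ℝ (Fin M) => l (projMean e x u)) := by
  simp_rw [projMean_eq]
  exact (hasLinearGrowth_of_lipschitzWith hLip).comp_clm (evalCLM H x ∘L synthesis e M)

variable [MeasurableSpace H] [BorelSpace H]

theorem measurable_projMean (e : ℕ → H) (x : Fin N → X) :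
    Measurable (fun u : EuclideanSpace ℝ (Fin M) => projMean e x u) := by
  simp_rw [projMean_eq]
  exact (measurable_evalAt x).comp (synthesis e M).continuous.measurable

variable [CompleteSpace H] [SecondCountableTopology H] {P : Measure H}

/-- The target of projected Langevin sampling as a tilt of the prior. -/
theorem plsMeasure_eq_tilted (hP : IsCenteredGaussian P C) (he : IsSpectralDecomposition C lam e)
    (hM : ∀ m < M, 0 < lam m) (hLip : LipschitzWith κ l) (x : Fin N → X) :
    plsMeasure P lam e M l x = P.tilted (fun f => - l (projMean e x (coeffs e M f))) := by
  have := hP.gaussian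
  have hlaw : plsCoeffLaw lam e M l x
      = (P.map (coeffs e M)).tilted (fun u => - l (projMean e x u)) := by
    have hint := integrable_exp_neg_half_sum (v := fun m : Fin M => (lam m).toNNReal)
      (fun m => (Real.toNNReal_pos.mpr (hM m m.2)).ne')
    simp_rw [fun m : Fin M => Real.coe_toNNReal _ (hM m m.2).le] at hint
    -- Successive tilts add exponents: the quadratic part of `V_∞` is the Gaussian factor and the
    -- loss is the remaining tilt.
    rw [map_coeffs_eq_tilted hP he hM, tilted_tilted hint, plsCoeffLaw]
    congr 1
    funext u
    simp only [plsPotential, Pi.add_apply]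
    ring
  rw [plsMeasure, hlaw]
  exact mixture_map_coeffs_tilted hP he hM
    (hLip.continuous.measurable.comp (measurable_projMean e x)).neg

theorem integrable_norm_of_lintegral_sq_lt_top {E : Type*} [NormedAddCommGroup E]
    [MeasurableSpace E] [BorelSpace E] [SecondCountableTopology E] {τ : Measure E}
    [IsFiniteMeasure τ] (h : ∫⁻ u, ‖u‖ₑ ^ 2 ∂τ < ∞) : Integrable (fun u => ‖u‖) τ := by
  have hmem : MemLp (fun u : E => u) 2 τ := by
    refine ⟨measurable_id.aestronglyMeasurable, ?_⟩
    rw [eLpNorm_lt_top_iff_lintegral_rpow_enorm_lt_top (by norm_num) (by norm_num)]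
    simpa using h
  exact (hmem.integrable (by norm_num)).norm

/-- The optimal variational approximation is the tilt of the prior by the mean loss. -/
theorem isOptimalApprox_iff (hP : IsCenteredGaussian P C) (he : IsSpectralDecomposition C lam e)
    (hM : ∀ m < M, 0 < lam m) (hLip : LipschitzWith κ l) (x : Fin N → X) (Q : Measure H) :
    IsOptimalApprox P e M l x Q
      ↔ Q = P.tilted (fun f => - meanLoss P e M l x (coeffs e M f)) := by
  have := hP.gaussian
  have hmc := measurable_coeffs e M
  have hmr := measurable_replaceCoeffs e M
  have hWm := measurable_meanLoss (P := P) (e := e) (M := M) hLip x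
  have hWn : Measurable (fun u => - meanLoss P e M l x u) := hWm.neg
  have hW := hasLinearGrowth_meanLoss (P := P) (e := e) (M := M) hLip x
  have hlm : Measurable (fun f : H => - l (evalAt x f)) :=
    (hLip.continuous.measurable.comp (measurable_evalAt x)).neg
  have hl : HasLinearGrowth (fun f : H => - l (evalAt x f)) :=
    ((hasLinearGrowth_of_lipschitzWith hLip).comp_clm (evalCLM H x)).neg
  have hhm : Measurable (fun f => - meanLoss P e M l x (coeffs e M f)) := (hWm.comp hmc).neg
  have hh : HasLinearGrowth (fun f => - meanLoss P e M l x (coeffs e M f)) :=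
    hW.comp_coeffs.neg
  refine isMinOn_klDiv_tilted_iff (hl.integrable_exp hlm) (hh.integrable_exp hhm) ?_ ?_ Q
  · rintro _ ⟨τ, hτ, hτ2, rfl⟩
    have hτ1 := integrable_norm_of_lintegral_sq_lt_top hτ2
    have hloss := integrable_loss (P := P) (e := e) hLip hτ1 x
    have hWint : Integrable (fun q : EuclideanSpace ℝ (Fin M) × H => meanLoss P e M l x q.1)
        (τ.prod P) := (hW.integrable hWm hτ1).comp_fst P
    rw [mixture_eq_map]
    refine ⟨Measure.isProbabilityMeasure_map hmr.aemeasurable, ?_, ?_, ?_⟩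
    · rw [integrable_map_measure hlm.aestronglyMeasurable hmr.aemeasurable]
      exact hloss.neg
    · rw [integrable_map_measure hhm.aestronglyMeasurable hmr.aemeasurable]
      simp only [Function.comp_def, coeffs_replaceCoeffs he hM]
      exact hWint.neg
    · rw [integral_map hmr.aemeasurable hlm.aestronglyMeasurable,
        integral_map hmr.aemeasurable hhm.aestronglyMeasurable]
      -- Under the mixture the coefficients are exactly `u`, so Fubini turns the expected loss into
      -- the expectation of `meanLoss` under `τ`.
      simp_rw [coeffs_replaceCoeffs he hM, integral_neg]
      rw [integral_prod _ hloss, integral_prod _ hWint]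
      simp [meanLoss]
  · have hγ : IsProbabilityMeasure (P.map (coeffs e M)) :=
      Measure.isProbabilityMeasure_map hmc.aemeasurable
    have hexp : Integrable (fun u => Real.exp (- meanLoss P e M l x u)) (P.map (coeffs e M)) := by
      rw [integrable_map_measure hWn.exp.aestronglyMeasurable hmc.aemeasurable]
      exact hh.integrable_exp hhm
    have hτ := isProbabilityMeasure_tilted hexp
    have hmix := mixture_map_coeffs_tilted hP he hM hWn
    refine ⟨_, hτ, ?_, hmix.symm⟩
    -- The candidate belongs to the family only if its mixing law has a finite second moment; this
    -- is computed under the tilted prior.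
    rw [← map_coeffs_mixture (P := P) he hM ((P.map (coeffs e M)).tilted _)]
    rw [hmix, lintegral_map (by fun_prop) hmc]
    have hsq : Integrable (fun f => ‖coeffs e M f‖ ^ 2)
        (P.tilted (fun f => - meanLoss P e M l x (coeffs e M f))) := by
      -- The constant `log 2` comes from `t² ≤ 2 exp t` for `t ≥ 0`.
      refine hh.integrable_tilted_of_le_exp hhm (hmc.norm.pow_const 2)
        (A := Real.log 2) (B := ‖coeffsCLM e M‖) (fun f => ?_)
      have h1 : ‖coeffs e M f‖ ≤ ‖coeffsCLM e M‖ * ‖f‖ := (coeffsCLM e M).le_opNorm f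
      have h0 : 0 ≤ ‖coeffsCLM e M‖ * ‖f‖ := by positivity
      rw [abs_of_nonneg (by positivity), Real.exp_add, Real.exp_log two_pos]
      have h2 := Real.quadratic_le_exp_of_nonneg h0
      have h3 : ‖coeffs e M f‖ ^ 2 ≤ (‖coeffsCLM e M‖ * ‖f‖) ^ 2 :=
        pow_le_pow_left₀ (norm_nonneg _) h1 2
      linarith
    have := hsq.2
    rw [hasFiniteIntegral_iff_enorm] at this
    simpa using! this

theorem klDiv_plsMeasure_le (hP : IsCenteredGaussian P C) (he : IsSpectralDecomposition C lam e)
    (hM : ∀ m < M, 0 < lam m) (hLip : LipschitzWith κ l) (hconv : ConvexOn ℝ Set.univ l)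
    (x : Fin N → X) :
    klDiv (plsMeasure P lam e M l x) (P.tilted (fun f => - meanLoss P e M l x (coeffs e M f)))
      ≤ ENNReal.ofReal ((κ : ℝ) ^ 2 / 2 * ∫ f, ‖evalAt x (residual e M f)‖ ^ 2 ∂P) := by
  have := hP.gaussian
  have hmc := measurable_coeffs e M
  have ham : Measurable (fun f => - l (projMean e x (coeffs e M f))) :=
    (hLip.continuous.measurable.comp ((measurable_projMean e x).comp hmc)).neg
  have ha : HasLinearGrowth (fun f => - l (projMean e x (coeffs e M f))) :=
    (hasLinearGrowth_projMean hLip e M x).comp_coeffs.neg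
  have hbm : Measurable (fun f => - meanLoss P e M l x (coeffs e M f)) :=
    ((measurable_meanLoss hLip x).comp hmc).neg
  have hb : HasLinearGrowth (fun f => - meanLoss P e M l x (coeffs e M f)) :=
    (hasLinearGrowth_meanLoss hLip x).comp_coeffs.neg
  rw [plsMeasure_eq_tilted hP he hM hLip]
  refine (klDiv_tilted_tilted_le (ha.integrable_exp ham) (hb.integrable_exp hbm)
    (ha.integrable_tilted ham ha ham) (ha.integrable_tilted ham hb hbm)
    (s := κ * √(∫ f, ‖evalAt x (residual e M f)‖ ^ 2 ∂P)) (fun f => ?_) (fun f => ?_)).trans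
    (le_of_eq ?_)
  · exact neg_le_neg (loss_projMean_le_meanLoss hP hLip hconv x _)
  · have := meanLoss_sub_loss_projMean_le (M := M) (e := e) hP hLip x (coeffs e M f)
    linarith
  · rw [mul_pow, Real.sq_sqrt (integral_nonneg fun f => by positivity)]
    congr 1
    ring

variable [MeasurableSpace X]

/-- Evaluation is the inner product of the function with the feature of the point, and the feature
map is measurable. -/
theorem measurable_evalAt_uncurry (hk : ∀ x : X, Measurable (kernelFun H x)) :
    Measurable (fun p : (Fin N → X) × H => evalAt p.1 p.2) := by
  refine (WithLp.measurable_toLp 2 _).comp (measurable_pi_lambda _ fun n => ?_)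
  simp_rw [← inner_feature]
  exact measurable_snd.inner
    ((measurable_feature hk).comp ((measurable_pi_apply n).comp measurable_fst))

/-- The divergence depends measurably on the inputs. -/
theorem measurable_klDiv_plsMeasure (hk : ∀ x : X, Measurable (kernelFun H x))
    (hP : IsCenteredGaussian P C) (he : IsSpectralDecomposition C lam e)
    (hM : ∀ m < M, 0 < lam m) (hLip : LipschitzWith κ l) :
    Measurable (fun x : Fin N → X => klDiv (plsMeasure P lam e M l x)
      (P.tilted (fun f => - meanLoss P e M l x (coeffs e M f)))) := by
  have := hP.gaussian
  have hmc := measurable_coeffs e M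
  have hE := measurable_evalAt_uncurry (H := H) (N := N) hk
  have hlm := hLip.continuous.measurable
  have haj : Measurable (fun p : (Fin N → X) × H => - l (projMean e p.1 (coeffs e M p.2))) := by
    simp_rw [projMean_eq]
    exact (hlm.comp (hE.comp (measurable_fst.prodMk
      ((synthesis e M).continuous.measurable.comp (hmc.comp measurable_snd))))).neg
  have hWj : Measurable (fun q : (Fin N → X) × EuclideanSpace ℝ (Fin M) =>
      meanLoss P e M l q.1 q.2) := by
    have : Measurable (fun r : ((Fin N → X) × EuclideanSpace ℝ (Fin M)) × H =>
        l (evalAt r.1.1 (replaceCoeffs e r.1.2 r.2))) :=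
      hlm.comp (hE.comp ((measurable_fst.comp measurable_fst).prodMk
        ((measurable_replaceCoeffs e M).comp
          ((measurable_snd.comp measurable_fst).prodMk measurable_snd))))
    exact this.stronglyMeasurable.integral_prod_right'.measurable
  have hbj : Measurable (fun p : (Fin N → X) × H =>
      - meanLoss P e M l p.1 (coeffs e M p.2)) :=
    (hWj.comp (measurable_fst.prodMk (hmc.comp measurable_snd))).neg
  simp_rw [plsMeasure_eq_tilted hP he hM hLip]
  have hyp : ∀ x : Fin N → X,
      Integrable (fun f => Real.exp (- l (projMean e x (coeffs e M f)))) P ∧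
      Integrable (fun f => Real.exp (- meanLoss P e M l x (coeffs e M f))) P ∧
      Integrable (fun f => - l (projMean e x (coeffs e M f)))
        (P.tilted (fun f => - l (projMean e x (coeffs e M f)))) ∧
      Integrable (fun f => - meanLoss P e M l x (coeffs e M f))
        (P.tilted (fun f => - l (projMean e x (coeffs e M f)))) := by
    intro x
    have ham : Measurable (fun f => - l (projMean e x (coeffs e M f))) :=
      (hlm.comp ((measurable_projMean e x).comp hmc)).neg
    have ha : HasLinearGrowth (fun f => - l (projMean e x (coeffs e M f))) :=
      (hasLinearGrowth_projMean hLip e M x).comp_coeffs.neg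
    have hbm : Measurable (fun f => - meanLoss P e M l x (coeffs e M f)) :=
      ((measurable_meanLoss hLip x).comp hmc).neg
    have hb : HasLinearGrowth (fun f => - meanLoss P e M l x (coeffs e M f)) :=
      (hasLinearGrowth_meanLoss hLip x).comp_coeffs.neg
    exact ⟨ha.integrable_exp ham, hb.integrable_exp hbm, ha.integrable_tilted ham ha ham,
      ha.integrable_tilted ham hb hbm⟩
  have key := measurable_klDiv_tilted_tilted (P := P) haj hbj
  exact key hyp

end Approximation

end FunctionSpaceInference

/-! ### The main theorem. -/

open FunctionSpaceInference in
theorem theorem2 {X H : Type*} [MeasurableSpace X]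
    [NormedAddCommGroup H] [InnerProductSpace ℝ H] [CompleteSpace H] [SecondCountableTopology H]
    [MeasurableSpace H] [BorelSpace H] [RKHS ℝ H X ℝ]
    (hk : ∀ x : X, Measurable (kernelFun H x))
    (ν : Measure X) [IsProbabilityMeasure ν]
    (hν : Integrable (fun x => kernelFun H x x) ν)
    (P : Measure H) (hP : IsCenteredGaussian P (covOp ν))
    (lam : ℕ → ℝ) (e : ℕ → H)
    (he : IsSpectralDecomposition (covOp ν : H → H) lam e)
    (M : ℕ) (hM : ∀ m < M, 0 < lam m)
    (N : ℕ) (l : EuclideanSpace ℝ (Fin N) → ℝ)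
    (κ : ℝ≥0) (hκ : 0 < κ) (hLip : LipschitzWith κ l) (hconv : ConvexOn ℝ Set.univ l) :
    ∃ Pstar : (Fin N → X) → Measure H,
      -- `Pstar x` is the unique optimal variational approximation
      (∀ x Q, IsOptimalApprox P e M l x Q ↔ Q = Pstar x) ∧
      -- fixed inputs
      (∀ x : Fin N → X,
        klDiv (plsMeasure P lam e M l x) (Pstar x) ≤
          ENNReal.ofReal ((κ : ℝ) ^ 2 / 2 * (residualCov ν lam e M x).trace) ∧
        HasSum (fun m => lam (M + m) * ∑ n, (e (M + m) (x n)) ^ 2)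
          (residualCov ν lam e M x).trace) ∧
      -- independent inputs with law `ν`
      Summable (fun m => lam (M + m) ^ 2) ∧
      AEMeasurable (fun x => klDiv (plsMeasure P lam e M l x) (Pstar x))
        (Measure.pi (fun _ : Fin N => ν)) ∧
      ∫⁻ x, klDiv (plsMeasure P lam e M l x) (Pstar x) ∂(Measure.pi (fun _ : Fin N => ν)) ≤
        ENNReal.ofReal (N * (κ : ℝ) ^ 2 / 2 * ∑' m, lam (M + m) ^ 2) := by
  have hbound : ∀ x : Fin N → X, klDiv (plsMeasure P lam e M l x)
      (P.tilted (fun f => - meanLoss P e M l x (coeffs e M f)))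
      ≤ ENNReal.ofReal ((κ : ℝ) ^ 2 / 2 * (residualCov ν lam e M x).trace) := by
    intro x
    rw [← integral_norm_sq_evalAt_residual hk hν hP he hM]
    exact klDiv_plsMeasure_le hP he hM hLip hconv x
  refine ⟨fun x => P.tilted (fun f => - meanLoss P e M l x (coeffs e M f)),
    isOptimalApprox_iff hP he hM hLip,
    fun x => ⟨hbound x, hasSum_trace_residualCov hk hν he x⟩, ?_,
    (measurable_klDiv_plsMeasure hk hP he hM hLip).aemeasurable, ?_⟩
  · simpa only [add_comm M] using (summable_nat_add_iff M).mpr (summable_eigen_sq hk hν he)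
  -- The bound for fixed inputs is integrated over the product law; only the expected trace remains
  -- to be evaluated.
  · refine (lintegral_mono hbound).trans (le_of_eq ?_)
    have hc : (0 : ℝ) ≤ (κ : ℝ) ^ 2 / 2 := by positivity
    simp_rw [ENNReal.ofReal_mul hc]
    rw [lintegral_const_mul' _ _ ENNReal.ofReal_ne_top, lintegral_trace_residualCov hk hν he,
      ← ENNReal.ofReal_mul hc]
    congr 1
    ring
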